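/- Let $\mathbb{F}_q$ be a finite field, let $\theta:\mathbb{F}_q^+\to\mathbb{C}^\times$ be a nontrivial homomorphism, and let $\mathfrak{n}$ be a finite-dimensional associative nilpotent $\mathbb{F}_q$-algebra with dual space $\mathfrak{n}^*$. For a subalgebra $\mathfrak h\subseteq\mathfrak n$ (including $\mathfrak h=\mathfrak n$) let $1+\mathfrak{h}$ be the group of formal sums $1+X$, $X\in\mathfrak{h}$, with $(1+X)(1+Y)=1+X+Y+XY$, and put $G=1+\mathfrak{n}$. The group $H=1+\mathfrak h$ acts on $\mathfrak h^*$ by $(g\nu)(X)=\nu(g^{-1}X)$ (left), $(\nu g)(X)=\nu(Xg^{-1})$ (right), and $\nu^g(X)=\nu(gXg^{-1})$ (coadjoint action, whose orbits are the coadjoint $H$-orbits). For $\lambda\in\mathfrak{n}^*$ define subspaces of $\mathfrak n$ by $\mathfrak{s}^0_\lambda=\mathfrak{n}$, $\mathfrak l_\lambda^0=0$ and, for $i\ge 0$, $$\mathfrak{l}^{i+1}_\lambda=\{X\in\mathfrak{s}^i_\lambda:\lambda(XY)=0\ \text{for all}\ Y\in\mathfrak{s}^i_\lambda\},\qquad \mathfrak{s}^{i+1}_\lambda=\{X\in\mathfrak{s}^i_\lambda:\lambda(XY)=0\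 \text{for all}\ Y\in\mathfrak{l}^{i+1}_\lambda\}.$$ These are subalgebras, and they form chains $\mathfrak l^0_\lambda\subseteq\mathfrak l^1_\lambda\subseteq\cdots\subseteq\mathfrak s^1_\lambda\subseteq\mathfrak s^0_\lambda$. Let $\overline{\mathfrak{l}}_\lambda=\mathfrak{l}^d_\lambda$ and $\overline{\mathfrak{s}}_\lambda=\mathfrak{s}^d_\lambda$ be their terminal members, where $d\geq1$ is the least integer with $\mathfrak{s}^{d-1}_\lambda=\mathfrak{s}^d_\lambda$, and put $\overline{L}_\lambda=1+\overline{\mathfrak{l}}_\lambda$, $\overline{S}_\lambda=1+\overline{\mathfrak{s}}_\lambda$. Let $\xi_\lambda=\mathrm{Ind}_{\overline{L}_\lambda}^{G}(\theta_\lambda)$ be the character of $G$ induced from the linear character $\theta_\lambda(g)=\theta(\lambda(g-1))$ of $\overline{L}_\lambda$, let $$\Xi_\lambda=\{g\lambda sg^{-1}:g\in G,\ s\in\overline{S}_\lambda\}\subseteq\mathfrak{n}^*,$$ and let $\mu\in(\overline{\mathfrak{s}}_\lambda)^*$ be the restriction of $\lambda$ to $\overline{\mathfrak{s}}_\lambda$.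 Then for every $\lambda\in\mathfrak n^*$ the number of distinct irreducible complex characters $\psi$ of $G$ with $\langle\xi_\lambda,\psi\rangle_G>0$ (the irreducible constituents of $\xi_\lambda$) equals the number of coadjoint $G$-orbits contained in $\Xi_\lambda$, and it also equals the number of coadjoint $\overline{S}_\lambda$-orbits contained in the right orbit $\mu\overline{S}_\lambda\subseteq(\overline{\mathfrak{s}}_\lambda)^*$. -/

import Mathlib

noncomputable section

/-! ### Functions on finite groups -/

section Characters

variable {G : Type*} [Group G]

/-- The inner product `⟨f, g⟩_G = |G|⁻¹ ∑ x, f x * conj (g x)` of functions on a finite group. -/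
def charInner (f g : G → ℂ) : ℂ :=
  (Nat.card G : ℂ)⁻¹ * ∑ᶠ x : G, f x * (starRingEnd ℂ) (g x)

variable (G) in
/-- The set of irreducible complex characters of `G`. -/
def irrCharacters : Set (G → ℂ) :=
  {χ | ∃ (d : ℕ) (ρ : Representation ℂ G (Fin d → ℂ)), ρ.IsIrreducible ∧ ρ.character = χ}

open scoped ComplexOrder in
/-- The irreducible constituents of `χ`: the irreducible characters `ψ` with `⟨χ, ψ⟩_G > 0`. -/
def irrConstituents (χ : G → ℂ) : Set (G → ℂ) :=
  {ψ | ψ ∈ irrCharacters G ∧ 0 < charInner χ ψ}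

/-- Induction from a subgroup `H` to `G` (Frobenius formula) of a function whose domain
includes `H`. -/
def inducedFun (H : Subgroup G) (χ : G → ℂ) (g : G) : ℂ :=
  (Nat.card H : ℂ)⁻¹ * ∑ᶠ (x : G) (_ : x * g * x⁻¹ ∈ H), χ (x * g * x⁻¹)

end Characters

/-! ### Nilpotent algebras and algebra groups -/

/-- `A` is nilpotent: for some `k`, every product `a₁ (a₂ (⋯ (a_k x)))` of `k + 1` elements of
`A` vanishes. -/
class IsNilpotentAlg (A : Type*) [NonUnitalRing A] : Prop where
  exists_prod_eq_zero : ∃ k : ℕ, ∀ (l : List A) (x : A), l.length = k → l.foldr (· * ·) x = 0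

/-- The algebra group `1 + A`: the set of formal sums `1 + X` with `X : A`. -/
@[ext]
structure AlgGroup (A : Type*) where
  /-- `oneAdd X` is the formal sum `1 + X`. -/
  oneAdd ::
  /-- `g.subOne` is the element `g - 1` of `A`. -/
  subOne : A

namespace AlgGroup

variable {A : Type*} [NonUnitalRing A]

instance : One (AlgGroup A) := ⟨oneAdd 0⟩

instance : Mul (AlgGroup A) := ⟨fun g h => oneAdd (g.subOne + h.subOne + g.subOne * h.subOne)⟩

@[simp] theorem subOne_one : (1 : AlgGroup A).subOne = 0 := rfl

@[simp] theorem subOne_mul (g h : AlgGroup A) :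
    (g * h).subOne = g.subOne + h.subOne + g.subOne * h.subOne := rfl

instance : Monoid (AlgGroup A) where
  mul_assoc a b c := by
    ext
    simp only [subOne_mul, mul_add, add_mul, mul_assoc]
    abel
  one_mul a := by ext; simp
  mul_one a := by ext; simp

theorem exists_mul_eq_one [IsNilpotentAlg A] (g : AlgGroup A) : ∃ h : AlgGroup A, g * h = 1 := by
  have key : ∀ k : ℕ, ∃ Y : A, g.subOne + Y + g.subOne * Y
      = (List.replicate k (-g.subOne)).foldr (· * ·) g.subOne := by
    intro k
    induction k with
    | zero => exact ⟨0, by simp⟩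
    | succ k ih =>
      obtain ⟨Y, hY⟩ := ih
      refine ⟨-(g.subOne + g.subOne * Y), ?_⟩
      rw [List.replicate_succ, List.foldr_cons, ← hY]
      simp only [mul_add, mul_neg, neg_mul, neg_add_rev]
      abel
  obtain ⟨k, hk⟩ := IsNilpotentAlg.exists_prod_eq_zero (A := A)
  obtain ⟨Y, hY⟩ := key k
  refine ⟨oneAdd Y, ?_⟩
  ext
  rw [subOne_mul, subOne_one, hY]
  exact hk _ _ (by simp)

instance [IsNilpotentAlg A] : Group (AlgGroup A) where
  inv g := (exists_mul_eq_one g).choose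
  inv_mul_cancel g := by
    have h1 := (exists_mul_eq_one g).choose_spec
    have h2 := (exists_mul_eq_one (exists_mul_eq_one g).choose).choose_spec
    have h3 := left_inv_eq_right_inv h1 h2
    rw [← h3] at h2
    exact h2

end AlgGroup

section Algebra

variable {F A : Type*} [Field F] [NonUnitalRing A] [Module F A]

/-- A subalgebra of a nilpotent algebra is nilpotent. -/
instance NonUnitalSubalgebra.isNilpotentAlg [IsNilpotentAlg A] (h : NonUnitalSubalgebra F A) :
    IsNilpotentAlg h where
  exists_prod_eq_zero := by
    obtain ⟨k, hk⟩ := IsNilpotentAlg.exists_prod_eq_zero (A := A)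
    refine ⟨k, fun l x hl => ?_⟩
    have key : ∀ l : List h, ((l.foldr (· * ·) x : h) : A)
        = (l.map (fun y : h => (y : A))).foldr (· * ·) (x : A) := by
      intro l
      induction l with
      | nil => rfl
      | cons a l ih => simp [ih]
    apply Subtype.ext
    rw [key l]
    exact hk _ _ (by simpa using hl)

/-- The algebra subgroup `1 + h` of `1 + A` attached to a subalgebra `h` of `A`. -/
def algSubgroup [IsNilpotentAlg A] (h : NonUnitalSubalgebra F A) : Subgroup (AlgGroup A) where
  carrier := {g | g.subOne ∈ h}
  one_mem' := h.zero_mem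
  mul_mem' {a b} ha hb := h.add_mem (h.add_mem ha hb) (h.mul_mem ha hb)
  inv_mem' {g} hg := by
    obtain ⟨y, hy⟩ := AlgGroup.exists_mul_eq_one (AlgGroup.oneAdd (⟨g.subOne, hg⟩ : h))
    have h1 : g * AlgGroup.oneAdd (y.subOne : A) = 1 := by
      ext
      simpa using congrArg (fun z : AlgGroup h => (z.subOne : A)) hy
    rw [inv_eq_of_mul_eq_one_right h1]
    exact y.subOne.2

/-- The restriction of a linear form on `A` to a subalgebra `h`. -/
def restrictForm (lam : Module.Dual F A) (h : NonUnitalSubalgebra F A) : Module.Dual F h :=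
  lam ∘ₗ (NonUnitalSubalgebraClass.subtype h : h →ₗ[F] A)

variable [IsScalarTower F A A] [SMulCommClass F A A]

/-! ### Actions of `1 + A` on the dual space of `A` -/

variable (F) in
/-- Left multiplication `X ↦ g X` by `g = 1 + Z`, that is, `X ↦ X + Z X`. -/
def leftMulMap (g : AlgGroup A) : A →ₗ[F] A := LinearMap.id + LinearMap.mulLeft F g.subOne

variable (F) in
/-- Right multiplication `X ↦ X g` by `g = 1 + Z`, that is, `X ↦ X + X Z`. -/
def rightMulMap (g : AlgGroup A) : A →ₗ[F] A := LinearMap.id + LinearMap.mulRight F g.subOne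

section Actions

variable [IsNilpotentAlg A]

/-- The left action `(g λ)(X) = λ(g⁻¹ X)`. -/
def leftAct (g : AlgGroup A) (lam : Module.Dual F A) : Module.Dual F A :=
  lam ∘ₗ leftMulMap F g⁻¹

/-- The right action `(λ g)(X) = λ(X g⁻¹)`. -/
def rightAct (lam : Module.Dual F A) (g : AlgGroup A) : Module.Dual F A :=
  lam ∘ₗ rightMulMap F g⁻¹

/-- The coadjoint action `λ^g(X) = λ(g X g⁻¹)`. -/
def coadjAct (lam : Module.Dual F A) (g : AlgGroup A) : Module.Dual F A :=
  lam ∘ₗ rightMulMap F g⁻¹ ∘ₗ leftMulMap F g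

/-- The right orbit `λ (1 + A)`. -/
def rightOrbit (lam : Module.Dual F A) : Set (Module.Dual F A) :=
  Set.range fun g : AlgGroup A => rightAct lam g

/-- The coadjoint orbit of `λ`. -/
def coadjOrbit (lam : Module.Dual F A) : Set (Module.Dual F A) :=
  Set.range fun g : AlgGroup A => coadjAct lam g

/-- The set of coadjoint `(1 + A)`-orbits contained in a set `X` of linear forms on `A`. -/
def coadjOrbitsIn (X : Set (Module.Dual F A)) : Set (Set (Module.Dual F A)) :=
  {O | (∃ nu : Module.Dual F A, O = coadjOrbit nu) ∧ O ⊆ X}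

end Actions

/-! ### The chains of subspaces attached to a linear form -/

/-- The left kernel `{X ∈ U : λ(X Y) = 0 for all Y ∈ V}` of the form `(X, Y) ↦ λ(X Y)` restricted
to `U × V`. -/
def leftKer (lam : Module.Dual F A) (U V : Submodule F A) : Submodule F A where
  carrier := {X | X ∈ U ∧ ∀ Y ∈ V, lam (X * Y) = 0}
  zero_mem' := ⟨U.zero_mem, fun Y _ => by simp⟩
  add_mem' {a b} ha hb := ⟨U.add_mem ha.1 hb.1, fun Y hY => by
    rw [add_mul, map_add, ha.2 Y hY, hb.2 Y hY, add_zero]⟩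
  smul_mem' c a ha := ⟨U.smul_mem c ha.1, fun Y hY => by
    rw [smul_mul_assoc, map_smul, ha.2 Y hY, smul_zero]⟩

/-- The descending chain: `s⁰ = A` and `sⁱ⁺¹ = {X ∈ sⁱ : λ(X Y) = 0 for all Y ∈ lⁱ⁺¹}`, where
`lⁱ⁺¹ = {X ∈ sⁱ : λ(X Y) = 0 for all Y ∈ sⁱ}`. -/
def sSeq (lam : Module.Dual F A) : ℕ → Submodule F A
  | 0 => ⊤
  | i + 1 => leftKer lam (sSeq lam i) (leftKer lam (sSeq lam i) (sSeq lam i))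

/-- The ascending chain: `l⁰ = 0` and `lⁱ⁺¹ = {X ∈ sⁱ : λ(X Y) = 0 for all Y ∈ sⁱ}`. -/
def lSeq (lam : Module.Dual F A) : ℕ → Submodule F A
  | 0 => ⊥
  | i + 1 => leftKer lam (sSeq lam i) (sSeq lam i)

theorem sSeq_mul_mem (lam : Module.Dual F A) (i : ℕ) :
    ∀ X Y : A, X ∈ sSeq lam i → Y ∈ sSeq lam i → X * Y ∈ sSeq lam i := by
  induction i with
  | zero => intro X Y _ _; exact Submodule.mem_top
  | succ i ih =>
    rintro X X' ⟨hX, hX0⟩ ⟨hX', hX'0⟩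
    refine ⟨ih _ _ hX hX', fun Y hY => ?_⟩
    rw [mul_assoc]
    refine hX0 _ ⟨ih _ _ hX' hY.1, fun Z hZ => ?_⟩
    rw [mul_assoc]
    refine hX'0 _ ⟨ih _ _ hY.1 hZ, fun W hW => ?_⟩
    rw [mul_assoc]
    exact hY.2 _ (ih _ _ hZ hW)

theorem lSeq_mul_mem (lam : Module.Dual F A) (i : ℕ) :
    ∀ X Y : A, X ∈ lSeq lam i → Y ∈ lSeq lam i → X * Y ∈ lSeq lam i := by
  cases i with
  | zero =>
    intro X Y hX _
    have h0 : X = 0 := hX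
    rw [h0, zero_mul]
    exact Submodule.zero_mem _
  | succ i =>
    rintro X Y ⟨hX, hX0⟩ ⟨hY, -⟩
    refine ⟨sSeq_mul_mem lam i _ _ hX hY, fun Z hZ => ?_⟩
    rw [mul_assoc]
    exact hX0 _ (sSeq_mul_mem lam i _ _ hY hZ)

/-- The least `d ≥ 1` with `s^{d-1} = s^d`; from this index on both chains are constant. -/
def chainIndex (lam : Module.Dual F A) : ℕ :=
  sInf {e : ℕ | sSeq lam e = sSeq lam (e + 1)} + 1

theorem exists_sSeq_eq [FiniteDimensional F A] (lam : Module.Dual F A) :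
    ∃ e : ℕ, sSeq lam e = sSeq lam (e + 1) := by
  have hanti : Antitone (sSeq lam) := antitone_nat_of_succ_le fun i X hX => hX.1
  obtain ⟨e, he⟩ := IsArtinian.monotone_stabilizes (⟨sSeq lam, hanti⟩ : ℕ →o (Submodule F A)ᵒᵈ)
  exact ⟨e, he (e + 1) (Nat.le_succ e)⟩

/-- The terminal subalgebra of the descending chain `sⁱ`. -/
def sBar (lam : Module.Dual F A) : NonUnitalSubalgebra F A :=
  (sSeq lam (chainIndex lam)).toNonUnitalSubalgebra (sSeq_mul_mem lam _)

/-- The terminal subalgebra of the ascending chain `lⁱ`. -/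
def lBar (lam : Module.Dual F A) : NonUnitalSubalgebra F A :=
  (lSeq lam (chainIndex lam)).toNonUnitalSubalgebra (lSeq_mul_mem lam _)

/-! ### The character `ξ_λ` and the set `Ξ_λ` -/

/-- The function `θ_λ(g) = θ(λ(g - 1))` on `1 + A`. -/
def thetaFun (θ : AddChar F ℂ) (lam : Module.Dual F A) (g : AlgGroup A) : ℂ :=
  θ (lam g.subOne)

variable [IsNilpotentAlg A]

/-- The character `ξ_λ`, induced from the restriction of `θ_λ` to `1 + lBar λ`. -/
def xiChar (θ : AddChar F ℂ) (lam : Module.Dual F A) : AlgGroup A → ℂ :=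
  inducedFun (algSubgroup (lBar lam)) (thetaFun θ lam)

/-- The set `Ξ_λ` of all `g λ s g⁻¹` with `g ∈ 1 + A` and `s ∈ 1 + sBar λ`. -/
def XiSet (lam : Module.Dual F A) : Set (Module.Dual F A) :=
  {nu | ∃ g : AlgGroup A, ∃ s ∈ algSubgroup (sBar lam),
    nu = rightAct (rightAct (leftAct g lam) s) g⁻¹}

end Algebra

end

/-! The functions θ_κ, κ ∈ n*, form an orthonormal basis of the functions on G = 1 + n, and class
functions are those whose Fourier coefficients are constant on coadjoint orbits. The heart is a
dichotomy (`dualCoeff_irr`): the coefficients of an irreducible ψ live entirely on Ξ_λ or entirely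
off it, and the first case occurs exactly for the constituents of ξ_λ. Hence these constituents are
a basis of the class functions with coefficients supported on Ξ_λ, a space whose dimension is the
number of coadjoint orbits in Ξ_λ.

Let E be the set `agreeSet` of forms equal to λ on the terminal l, with L and S the terminal groups.
Induction along the chains gives two facts. If κ and κ^x lie in E, then x ∈ S
(`mem_of_coadjAct_mem_agreeSet`). If κ ∈ E and ν has the same restriction as κ to the terminal s,
then κ and ν are S-conjugate (`exists_coadjAct_eq_of_eqOn_sBar`). It follows that Ξ_λ is the
saturation of E, and that restriction to the terminal s matches G-orbits meeting E with S-orbits in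
μS; this is the second equality.

For the dichotomy, let a be the coefficients of ψ and f the function with coefficients a·1_E. On S,
f is the character σ of S on the θ_λ-isotypic part of ψ (`dualSynth_indicator_of_mem`); off S it
vanishes (`dualSynth_indicator_of_notMem`). Parseval and a double count
(`card_mul_sum_indicator_XiSet`) give ∑_{Ξ_λ} |a|² = ⟨σ, σ⟩_S, an integer. As ∑ |a|² = ⟨ψ, ψ⟩ = 1
over all of n*, that integer is 0 or 1. By Frobenius reciprocity σ(1) is the multiplicity of ψ in
ξ_λ, so 0 means that ψ is not a constituent. -/

set_option linter.unusedSectionVars false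

/-! ### Irreducible characters of a finite group: orthonormality and completeness. -/

open Module LinearMap in
open scoped ComplexOrder in
/-- Complex conjugation inverts the argument of a character of a finite group. -/
theorem conj_character {V : Type*} [AddCommGroup V] [Module ℂ V]
    [FiniteDimensional ℂ V] {G : Type*} [Group G] [Finite G] (ρ : Representation ℂ G V) (g : G) :
    (starRingEnd ℂ) (ρ.character g) = ρ.character g⁻¹ := by
  classical
  have := Fintype.ofFinite G
  let b := Module.finBasis ℂ V
  let M : G → Matrix (Fin (finrank ℂ V)) (Fin (finrank ℂ V)) ℂ := fun x => toMatrix b b (ρ x)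
  have hM : ∀ x y, M (x * y) = M x * M y := fun x y => by
    simp only [M, map_mul]; exact LinearMap.toMatrix_mul b (ρ x) (ρ y)
  have hM1 : M 1 = 1 := by simp only [M, map_one]; exact LinearMap.toMatrix_one b
  -- The averaged Hermitian form, for which every `M x` is unitary. Its term at `x = 1` is the
  -- identity, whence definiteness; then the conjugate transpose of `M g` is similar to `M g⁻¹`.
  let H := ∑ x : G, (M x).conjTranspose * M x
  have hH : H.PosDef := by
    have h1 : ∀ x, ((M x).conjTranspose * M x).PosSemidef := fun x =>
      Matrix.posSemidef_conjTranspose_mul_self (M x)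
    have h2 : ((M 1).conjTranspose * M 1).PosDef := by
      rw [hM1]; simpa using Matrix.PosDef.one
    have h3 : H = (M 1).conjTranspose * M 1 +
        ∑ x ∈ Finset.univ.erase (1 : G), (M x).conjTranspose * M x :=
      (Finset.add_sum_erase _ _ (Finset.mem_univ _)).symm
    rw [h3]
    exact h2.add_posSemidef (Matrix.posSemidef_sum _ fun x _ => h1 x)
  have hinv : (M g).conjTranspose * H = H * M g⁻¹ := by
    simp only [H, Finset.mul_sum, Finset.sum_mul]
    refine Fintype.sum_equiv (Equiv.mulRight g) _ _ fun x => ?_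
    rw [Equiv.coe_mulRight, hM x g, Matrix.conjTranspose_mul, Matrix.mul_assoc, Matrix.mul_assoc,
      Matrix.mul_assoc, ← hM g, mul_inv_cancel, hM1, Matrix.mul_one]
  have hu : IsUnit H.det := (Matrix.isUnit_iff_isUnit_det _).1 hH.isUnit
  have hconj : (M g).conjTranspose = H * M g⁻¹ * H⁻¹ := by
    rw [← hinv, Matrix.mul_assoc, Matrix.mul_nonsing_inv _ hu, Matrix.mul_one]
  have ht : ∀ x, ρ.character x = (M x).trace := fun x =>
    LinearMap.trace_eq_matrix_trace ℂ b (ρ x)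
  rw [ht, ht, ← Complex.star_def, ← Matrix.trace_conjTranspose, hconj, Matrix.trace_mul_comm,
    ← Matrix.mul_assoc, Matrix.nonsing_inv_mul _ hu, Matrix.one_mul]

noncomputable section

section CharacterTheory

variable {G : Type*} [Group G] [Finite G]

theorem charInner_eq_sum [Fintype G] (f g : G → ℂ) :
    charInner f g = (Nat.card G : ℂ)⁻¹ * ∑ x, f x * (starRingEnd ℂ) (g x) := by
  rw [charInner, finsum_eq_sum_of_fintype]

/-- The norm of a character is the dimension of its space of endomorphisms. -/
theorem charInner_character_self {V : Type*} [AddCommGroup V] [Module ℂ V] [FiniteDimensional ℂ V]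
    (ρ : Representation ℂ G V) : ∃ n : ℕ, charInner ρ.character ρ.character = n := by
  have := Fintype.ofFinite G
  have : Invertible (Nat.card G : ℂ) := invertibleOfNonzero (by simp)
  refine ⟨Module.finrank ℂ (ρ.IntertwiningMap ρ), ?_⟩
  rw [charInner_eq_sum, ← Representation.card_inv_mul_sum_char_mul_char_eq_finrank ρ ρ]
  simp only [conj_character]

theorem charInner_irr_self {χ : G → ℂ} (hχ : χ ∈ irrCharacters G) : charInner χ χ = 1 := by
  have := Fintype.ofFinite G
  have : Invertible (Nat.card G : ℂ) := invertibleOfNonzero (by simp)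
  obtain ⟨d, ρ, hρ, rfl⟩ := hχ
  rw [charInner_eq_sum]
  simp only [conj_character]
  rw [Representation.char_orthonormal, if_pos ⟨.refl ρ⟩]

theorem charInner_irr_of_ne {χ ψ : G → ℂ} (hχ : χ ∈ irrCharacters G) (hψ : ψ ∈ irrCharacters G)
    (h : χ ≠ ψ) : charInner χ ψ = 0 := by
  have := Fintype.ofFinite G
  have : Invertible (Nat.card G : ℂ) := invertibleOfNonzero (by simp)
  obtain ⟨d, ρ, hρ, rfl⟩ := hχ
  obtain ⟨e, σ, hσ, rfl⟩ := hψ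
  rw [charInner_eq_sum]
  simp only [conj_character]
  rw [Representation.char_orthonormal, if_neg]
  rintro ⟨φ⟩
  exact h (Representation.char_iso φ).symm

/-- The inner product against a fixed function, as a linear form. -/
def charInnerLeft (g : G → ℂ) : (G → ℂ) →ₗ[ℂ] ℂ where
  toFun f := charInner f g
  map_add' f f' := by
    have := Fintype.ofFinite G
    simp [charInner_eq_sum, add_mul, Finset.sum_add_distrib, mul_add]
  map_smul' c f := by
    have := Fintype.ofFinite G
    simp only [charInner_eq_sum, Pi.smul_apply, smul_eq_mul, mul_assoc, ← Finset.mul_sum,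
      RingHom.id_apply]
    ring

theorem charInnerLeft_apply (f g : G → ℂ) : charInnerLeft g f = charInner f g := rfl

variable (G) in
theorem linearIndependent_irrCharacters :
    LinearIndependent ℂ ((↑) : irrCharacters G → G → ℂ) := by
  classical
  rw [linearIndependent_iff']
  intro s c hc i hi
  have h := congrArg (charInnerLeft (i : G → ℂ)) hc
  rw [map_sum, map_zero, Finset.sum_eq_single i] at h
  · simpa [charInnerLeft_apply, charInner_irr_self i.2] using h
  · intro j _ hj
    rw [map_smul, charInnerLeft_apply, charInner_irr_of_ne j.2 i.2 (fun e => hj (Subtype.ext e)),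
      smul_zero]
  · exact fun h => absurd hi h

variable (G) in
theorem finite_irrCharacters : (irrCharacters G).Finite :=
  (linearIndependent_irrCharacters G).setFinite

open Module in
/-- The character of an irreducible representation on any space is in `irrCharacters`. -/
theorem character_mem_irrCharacters {V : Type*} [AddCommGroup V] [Module ℂ V]
    [FiniteDimensional ℂ V] (ρ : Representation ℂ G V) (hρ : ρ.IsIrreducible) :
    ρ.character ∈ irrCharacters G := by
  let e : V ≃ₗ[ℂ] (Fin (finrank ℂ V) → ℂ) := (finBasis ℂ V).equivFun
  let σ : Representation ℂ G (Fin (finrank ℂ V) → ℂ) :=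
    { toFun := fun g => e.conj (ρ g)
      map_one' := by rw [map_one]; exact e.conj_id
      map_mul' := fun x y => by rw [map_mul]; ext; simp [LinearEquiv.conj_apply] }
  let φ : ρ.Equiv σ := .mk e fun g => by ext v; simp [σ, LinearEquiv.conj_apply]
  refine ⟨_, σ, ?_, (Representation.char_iso φ).symm⟩
  rw [Representation.irreducible_iff_isSimpleModule_asModule] at hρ ⊢
  let ψ := Representation.IntertwiningMap.equivLinearMapAsModule ρ σ φ.toIntertwiningMap
  have hψ : Function.Bijective ψ := e.bijective
  exact IsSimpleModule.congr (LinearEquiv.ofBijective ψ hψ).symm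

/-- A class function orthogonal to all irreducible characters acts by zero on all
representations. -/
theorem sum_conj_smul_eq_zero [Fintype G] {f : G → ℂ} (hf : ∀ x y, f (x * y * x⁻¹) = f y)
    (h0 : ∀ ψ ∈ irrCharacters G, charInner f ψ = 0) (n : ℕ) :
    ∀ {V : Type*} [AddCommGroup V] [Module ℂ V] [FiniteDimensional ℂ V]
      (ρ : Representation ℂ G V), Module.finrank ℂ V ≤ n →
      ∑ g : G, (starRingEnd ℂ) (f g) • ρ g = 0 := by
  induction n with
  | zero =>
    intro V _ _ _ ρ hV
    have := Module.finrank_zero_iff.1 (Nat.le_zero.1 hV)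
    exact Subsingleton.elim _ _
  | succ n ih =>
    intro V _ _ _ ρ hV
    by_cases hρ : ρ.IsIrreducible
    -- Schur: the sum is a scalar, and its trace is |G| times the conjugate of ⟨f, χ⟩ = 0.
    · let T : ρ.IntertwiningMap ρ := ⟨∑ g : G, (starRingEnd ℂ) (f g) • ρ g, fun x => by
        change _ * ρ x = ρ x * _
        rw [Finset.sum_mul, Finset.mul_sum]
        refine Fintype.sum_equiv (MulAut.conj x⁻¹).toEquiv _ _ fun g => ?_
        have h1 : f (x⁻¹ * g * x) = f g := by simpa using hf x⁻¹ g
        simp [← map_mul, ← mul_assoc, h1]⟩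
      obtain ⟨c, hc⟩ :=
        (Representation.IsIrreducible.algebraMap_intertwiningMap_bijective_of_isAlgClosed
          (ρ := ρ)).2 T
      have hT : ∑ g : G, (starRingEnd ℂ) (f g) • ρ g = c • LinearMap.id :=
        (congrArg (fun t => t.toLinearMap) hc).symm
      have htr : LinearMap.trace ℂ V (∑ g : G, (starRingEnd ℂ) (f g) • ρ g) = 0 := by
        have h1 := h0 _ (character_mem_irrCharacters ρ hρ)
        rw [charInner_eq_sum, mul_eq_zero, or_iff_right (inv_ne_zero (by simp))] at h1
        simpa [Representation.character] using congrArg (starRingEnd ℂ) h1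
      rw [hT, map_smul, LinearMap.trace_id, smul_eq_mul, mul_eq_zero] at htr
      rcases htr with h | h
      · rw [hT, h, zero_smul]
      · have := Module.finrank_zero_iff.1 (Nat.cast_eq_zero.1 h)
        exact Subsingleton.elim _ _
    · rcases subsingleton_or_nontrivial V with hs | hs
      · exact Subsingleton.elim _ _
      have : Nontrivial (Subrepresentation ρ) := by
        refine ⟨⊥, ⊤, fun h => ?_⟩
        exact bot_ne_top (α := Submodule ℂ V) (congrArg Subrepresentation.toSubmodule h)
      obtain ⟨W, hW⟩ : ∃ W : Subrepresentation ρ, ¬ (W = ⊥ ∨ W = ⊤) := by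
        by_contra! hcon
        exact hρ ⟨hcon⟩
      push Not at hW
      -- Maschke: V splits into two proper subrepresentations, both covered by the induction
      -- hypothesis.
      have hss : ρ.IsSemisimpleRepresentation := by
        rw [Representation.isSemisimpleRepresentation_iff_isSemisimpleModule_asModule]
        infer_instance
      obtain ⟨W', hW'⟩ := exists_isCompl W
      have hzero : ∀ U : Subrepresentation ρ, U ≠ ⊤ → ∀ v ∈ U.toSubmodule,
          (∑ g : G, (starRingEnd ℂ) (f g) • ρ g) v = 0 := by
        intro U hU v hv
        have hlt : Module.finrank ℂ U.toSubmodule < Module.finrank ℂ V :=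
          Submodule.finrank_lt fun h => hU (Subrepresentation.toSubmodule_injective h)
        have h1 := ih U.toRepresentation (by omega)
        have h2 := congrArg (fun t => ((t ⟨v, hv⟩ : U.toSubmodule) : V)) h1
        simpa [Subrepresentation.toRepresentation, LinearMap.sum_apply] using h2
      have hW'top : W' ≠ ⊤ := by
        rintro rfl
        exact hW.1 (by simpa using hW'.inf_eq_bot)
      ext v
      have hv : v ∈ W.toSubmodule ⊔ W'.toSubmodule := by
        have : W.toSubmodule ⊔ W'.toSubmodule = ⊤ :=
          congrArg Subrepresentation.toSubmodule hW'.sup_eq_top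
        rw [this]; trivial
      obtain ⟨a, ha, b, hb, rfl⟩ := Submodule.mem_sup.1 hv
      rw [map_add, hzero W hW.2 a ha, hzero W' hW'top b hb]
      simp

/-- A class function orthogonal to all irreducible characters vanishes. -/
theorem eq_zero_of_charInner_irr_eq_zero {f : G → ℂ} (hf : ∀ x y, f (x * y * x⁻¹) = f y)
    (h0 : ∀ ψ ∈ irrCharacters G, charInner f ψ = 0) : f = 0 := by
  classical
  have := Fintype.ofFinite G
  let ρ : Representation ℂ G (G → ℂ) :=
    { toFun := fun g => LinearMap.funLeft ℂ ℂ (fun x => x * g)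
      map_one' := by ext; simp [LinearMap.funLeft]
      map_mul' := fun x y => by ext; simp [LinearMap.funLeft, mul_assoc] }
  have h := sum_conj_smul_eq_zero hf h0 _ ρ le_rfl
  funext g
  -- In the regular representation, applying the operator to the delta function at `g` and
  -- evaluating at 1 isolates the conjugate of `f g`.
  have h1 := congrFun (congrArg (fun t => t (Pi.single g 1)) h) 1
  simpa [ρ, LinearMap.sum_apply, LinearMap.funLeft_apply, Pi.single_apply] using h1

theorem classFun_mem_span_irrCharacters {f : G → ℂ} (hf : ∀ x y, f (x * y * x⁻¹) = f y) :
    f ∈ Submodule.span ℂ (irrCharacters G) := by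
  classical
  have := (finite_irrCharacters G).fintype
  let p : G → ℂ := ∑ ψ : irrCharacters G, charInner f ψ • (ψ : G → ℂ)
  have hp : p ∈ Submodule.span ℂ (irrCharacters G) :=
    Submodule.sum_mem _ fun ψ _ => Submodule.smul_mem _ _ (Submodule.subset_span ψ.2)
  have hfp : f - p = 0 := by
    refine eq_zero_of_charInner_irr_eq_zero (fun x y => ?_) fun ψ hψ => ?_
    · simp only [Pi.sub_apply, hf, p, Finset.sum_apply, Pi.smul_apply]
      congr 1
      refine Finset.sum_congr rfl fun ψ _ => ?_
      obtain ⟨d, ρ, -, hρ⟩ := ψ.2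
      rw [← hρ, Representation.char_conj]
    · rw [← charInnerLeft_apply, map_sub, map_sum, Finset.sum_eq_single ⟨ψ, hψ⟩]
      · simp [charInnerLeft_apply, charInner_irr_self hψ]
      · intro χ _ hχ
        rw [map_smul, charInnerLeft_apply, charInner_irr_of_ne χ.2 hψ
          (fun e => hχ (Subtype.ext e)), smul_zero]
      · simp
  rw [sub_eq_zero.1 hfp]
  exact hp

end CharacterTheory

/-! ### Left and right multiplication by 1 + A, and coadjoint orbits. -/

section Multiplication

variable {F A : Type*} [Field F] [NonUnitalRing A] [Module F A]
  [IsScalarTower F A A] [SMulCommClass F A A]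

theorem leftMulMap_apply (g : AlgGroup A) (X : A) : leftMulMap F g X = X + g.subOne * X := rfl

theorem rightMulMap_apply (g : AlgGroup A) (X : A) : rightMulMap F g X = X + X * g.subOne := rfl

theorem leftMulMap_leftMulMap (g h : AlgGroup A) (X : A) :
    leftMulMap F g (leftMulMap F h X) = leftMulMap F (g * h) X := by
  simp only [leftMulMap_apply, AlgGroup.subOne_mul, mul_add, add_mul, mul_assoc]
  abel

theorem rightMulMap_rightMulMap (g h : AlgGroup A) (X : A) :
    rightMulMap F g (rightMulMap F h X) = rightMulMap F (h * g) X := by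
  simp only [rightMulMap_apply, AlgGroup.subOne_mul, mul_add, add_mul, mul_assoc]
  abel

theorem leftMulMap_rightMulMap (g h : AlgGroup A) (X : A) :
    leftMulMap F g (rightMulMap F h X) = rightMulMap F h (leftMulMap F g X) := by
  simp only [rightMulMap_apply, leftMulMap_apply, mul_add, add_mul, mul_assoc]
  abel

theorem leftMulMap_one (X : A) : leftMulMap F (1 : AlgGroup A) X = X := by
  simp [leftMulMap_apply]

theorem rightMulMap_one (X : A) : rightMulMap F (1 : AlgGroup A) X = X := by
  simp [rightMulMap_apply]

theorem rightMulMap_mul (g : AlgGroup A) (X Y : A) :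
    rightMulMap F g (X * Y) = X * rightMulMap F g Y := by
  simp only [rightMulMap_apply, mul_add, mul_assoc]

variable [IsNilpotentAlg A]

theorem coadjAct_apply (κ : Module.Dual F A) (g : AlgGroup A) (X : A) :
    coadjAct κ g X = κ (rightMulMap F g⁻¹ (leftMulMap F g X)) := rfl

theorem coadjAct_coadjAct (κ : Module.Dual F A) (g h : AlgGroup A) :
    coadjAct (coadjAct κ g) h = coadjAct κ (g * h) := by
  ext X
  simp only [coadjAct_apply, leftMulMap_rightMulMap, rightMulMap_rightMulMap,
    leftMulMap_leftMulMap, mul_inv_rev]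

theorem coadjAct_one (κ : Module.Dual F A) : coadjAct κ 1 = κ := by
  ext X
  rw [coadjAct_apply, inv_one, leftMulMap_one, rightMulMap_one]

theorem mem_coadjOrbit_self (κ : Module.Dual F A) : κ ∈ coadjOrbit κ := ⟨1, coadjAct_one κ⟩

theorem coadjOrbit_coadjAct (κ : Module.Dual F A) (g : AlgGroup A) :
    coadjOrbit (coadjAct κ g) = coadjOrbit κ := by
  ext ν
  constructor
  · rintro ⟨h, rfl⟩
    exact ⟨g * h, (coadjAct_coadjAct κ g h).symm⟩
  · rintro ⟨h, rfl⟩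
    exact ⟨g⁻¹ * h, by simp only [coadjAct_coadjAct, mul_inv_cancel_left]⟩

theorem coadjOrbit_eq_iff (κ ν : Module.Dual F A) :
    coadjOrbit κ = coadjOrbit ν ↔ ∃ g, coadjAct κ g = ν := by
  constructor
  · intro h
    have : ν ∈ coadjOrbit κ := h ▸ mem_coadjOrbit_self ν
    exact this
  · rintro ⟨g, rfl⟩
    exact (coadjOrbit_coadjAct κ g).symm

end Multiplication

/-! ### Ideal properties of the chains sⁱ and lⁱ. -/

section Chains

variable {F A : Type*} [Field F] [NonUnitalRing A] [Module F A]
  [IsScalarTower F A A] [SMulCommClass F A A]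

/-- A linear form vanishing on the left kernel of `(X, Y) ↦ λ(X Y)` on `U × V` is represented
on `U` by an element of `V`. -/
theorem exists_mem_eq_apply_mul [FiniteDimensional F A] (lam φ : Module.Dual F A)
    (U V : Submodule F A) (h : ∀ X ∈ leftKer lam U V, φ X = 0) :
    ∃ Y ∈ V, ∀ X ∈ U, φ X = lam (X * Y) := by
  let Ψ : V →ₗ[F] Module.Dual F U :=
    LinearMap.mk₂ F (fun (Y : V) (X : U) => lam ((X : A) * Y))
      (fun Y Y' X => by simp [mul_add]) (fun c Y X => by simp [mul_smul_comm])
      (fun Y X X' => by simp [add_mul]) (fun c Y X => by simp [smul_mul_assoc])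
  have hmem : φ ∘ₗ U.subtype ∈ LinearMap.range Ψ := by
    -- In finite dimension a subspace of the dual is the annihilator of its common zeros, and the
    -- common zeros of the range are `leftKer lam U V`.
    rw [← Subspace.dualCoannihilator_dualAnnihilator_eq (W := LinearMap.range Ψ),
      Submodule.mem_dualAnnihilator]
    intro X hX
    rw [Submodule.mem_dualCoannihilator] at hX
    exact h X ⟨X.2, fun Y hY => hX (Ψ ⟨Y, hY⟩) ⟨_, rfl⟩⟩
  obtain ⟨Y, hY⟩ := hmem
  exact ⟨Y, Y.2, fun X hX => (LinearMap.congr_fun hY ⟨X, hX⟩).symm⟩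

theorem sSeq_antitone (lam : Module.Dual F A) : Antitone (sSeq lam) :=
  antitone_nat_of_succ_le fun _ _ hX => hX.1

theorem lSeq_le_sSeq (lam : Module.Dual F A) (i : ℕ) : lSeq lam i ≤ sSeq lam i := by
  cases i with
  | zero => exact bot_le
  | succ i => exact fun X hX => ⟨hX.1, fun Y hY => hX.2 Y hY.1⟩

theorem lSeq_monotone (lam : Module.Dual F A) : Monotone (lSeq lam) := by
  refine monotone_nat_of_le_succ fun i => ?_
  cases i with
  | zero => exact bot_le
  | succ i => exact fun X hX => ⟨lSeq_le_sSeq lam _ hX, fun Y hY => hX.2 Y hY.1⟩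

theorem lSeq_mul_sSeq_mem {lam : Module.Dual F A} {i : ℕ} {X Y : A} (hX : X ∈ lSeq lam (i + 1))
    (hY : Y ∈ sSeq lam i) : X * Y ∈ lSeq lam (i + 1) :=
  ⟨sSeq_mul_mem lam i _ _ hX.1 hY, fun Z hZ => by
    rw [mul_assoc]; exact hX.2 _ (sSeq_mul_mem lam i _ _ hY hZ)⟩

/-- For Z ∈ sⁱ the product YZ is again in lⁱ⁺¹, and X ∈ sⁱ⁺¹ pairs to zero with it. With
`lSeq_mul_sSeq_mem` this makes lⁱ⁺¹ a two-sided ideal of sⁱ⁺¹. -/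
theorem sSeq_mul_lSeq_mem {lam : Module.Dual F A} {i : ℕ} {X Y : A}
    (hX : X ∈ sSeq lam (i + 1)) (hY : Y ∈ lSeq lam (i + 1)) : X * Y ∈ lSeq lam (i + 1) :=
  ⟨sSeq_mul_mem lam i _ _ hX.1 hY.1, fun Z hZ => by
    rw [mul_assoc]; exact hX.2 _ (lSeq_mul_sSeq_mem hY hZ)⟩

theorem mem_sBar {lam : Module.Dual F A} {X : A} :
    X ∈ sBar lam ↔ X ∈ sSeq lam (chainIndex lam) := Iff.rfl

theorem lBar_le_sBar {lam : Module.Dual F A} {X : A} (hX : X ∈ lBar lam) : X ∈ sBar lam :=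
  lSeq_le_sSeq lam _ hX

theorem lBar_mul_sBar_mem {lam : Module.Dual F A} {X Y : A} (hX : X ∈ lBar lam)
    (hY : Y ∈ sBar lam) : X * Y ∈ lBar lam :=
  lSeq_mul_sSeq_mem hX (sSeq_antitone lam (Nat.le_succ _) hY)

theorem sBar_mul_lBar_mem {lam : Module.Dual F A} {X Y : A} (hX : X ∈ sBar lam)
    (hY : Y ∈ lBar lam) : X * Y ∈ lBar lam :=
  sSeq_mul_lSeq_mem hX hY

theorem apply_lBar_mul_sBar {lam : Module.Dual F A} {X Y : A} (hX : X ∈ lBar lam)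
    (hY : Y ∈ sBar lam) : lam (X * Y) = 0 :=
  hX.2 Y (sSeq_antitone lam (Nat.le_succ _) hY)

theorem apply_sBar_mul_lBar {lam : Module.Dual F A} {X Y : A} (hX : X ∈ sBar lam)
    (hY : Y ∈ lBar lam) : lam (X * Y) = 0 :=
  hX.2 Y hY

/-- `chainIndex` is e + 1 with sᵉ = sᵉ⁺¹, and lᵉ⁺¹ is the left kernel on sᵉ; so at the end of the
chains `lBar` is the whole left kernel on `sBar`. -/
theorem mem_lBar_of_apply_mul [FiniteDimensional F A] {lam : Module.Dual F A} {X : A}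
    (hX : X ∈ sBar lam) (h : ∀ Y ∈ sBar lam, lam (X * Y) = 0) : X ∈ lBar lam := by
  have he := Nat.sInf_mem (exists_sSeq_eq lam)
  have hs : sSeq lam (chainIndex lam) = sSeq lam (sInf {e | sSeq lam e = sSeq lam (e + 1)}) :=
    he.symm
  refine ⟨?_, fun Y hY => h Y ?_⟩
  · rw [← hs]; exact hX
  · rw [mem_sBar, hs]; exact hY

variable [IsNilpotentAlg A]

/-- The group `1 + sⁱ`. -/
def sGroup (lam : Module.Dual F A) (i : ℕ) : Subgroup (AlgGroup A) :=
  algSubgroup ((sSeq lam i).toNonUnitalSubalgebra (sSeq_mul_mem lam i))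

/-- The group `1 + lⁱ`. -/
def lGroup (lam : Module.Dual F A) (i : ℕ) : Subgroup (AlgGroup A) :=
  algSubgroup ((lSeq lam i).toNonUnitalSubalgebra (lSeq_mul_mem lam i))

theorem mem_sGroup {lam : Module.Dual F A} {i : ℕ} {g : AlgGroup A} :
    g ∈ sGroup lam i ↔ g.subOne ∈ sSeq lam i := Iff.rfl

theorem mem_algSubgroup {h : NonUnitalSubalgebra F A} {g : AlgGroup A} :
    g ∈ algSubgroup h ↔ g.subOne ∈ h := Iff.rfl

theorem rightMulMap_mem_lSeq {lam : Module.Dual F A} {i : ℕ} {X : A} {g : AlgGroup A}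
    (hX : X ∈ lSeq lam (i + 1)) (hg : g ∈ sGroup lam i) :
    rightMulMap F g X ∈ lSeq lam (i + 1) :=
  Submodule.add_mem _ hX (lSeq_mul_sSeq_mem hX hg)

theorem apply_rightMulMap_lSeq {lam : Module.Dual F A} {i : ℕ} {X : A} {g : AlgGroup A}
    (hX : X ∈ lSeq lam (i + 1)) (hg : g ∈ sGroup lam i) : lam (rightMulMap F g X) = lam X := by
  rw [rightMulMap_apply, map_add, hX.2 _ hg, add_zero]

/-- A form agreeing with `λ` on `lⁱ⁺¹` is on `sⁱ` a right translate of `λ`. -/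
theorem exists_eq_apply_rightMulMap [FiniteDimensional F A] {lam κ : Module.Dual F A} {i : ℕ}
    (hκ : ∀ Y ∈ lSeq lam (i + 1), κ Y = lam Y) :
    ∃ h ∈ sGroup lam i, ∀ X ∈ sSeq lam i, κ X = lam (rightMulMap F h X) := by
  obtain ⟨W, hW, h⟩ := exists_mem_eq_apply_mul lam (κ - lam) (sSeq lam i) (sSeq lam i)
    fun X hX => sub_eq_zero.2 (hκ X hX)
  refine ⟨.oneAdd W, hW, fun X hX => ?_⟩
  rw [rightMulMap_apply, map_add, ← h X hX]
  simp

/-- Write κ(X) = λ(Xh) on sⁱ with h ∈ 1 + sⁱ. Evaluating κ^x at Yh⁻¹x, which stays in lⁱ⁺¹, gives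
κ(xYh⁻¹) = λ(xY) on one side and λ(Y) on the other, so λ((x − 1)Y) = 0. -/
theorem mem_sGroup_succ [FiniteDimensional F A] {lam κ : Module.Dual F A} {i : ℕ}
    {x : AlgGroup A} (hx : x ∈ sGroup lam i) (hκ : ∀ Y ∈ lSeq lam (i + 1), κ Y = lam Y)
    (hκx : ∀ Y ∈ lSeq lam (i + 1), coadjAct κ x Y = lam Y) : x ∈ sGroup lam (i + 1) := by
  obtain ⟨h, hh, hκh⟩ := exists_eq_apply_rightMulMap hκ
  refine ⟨hx, fun Y hY => ?_⟩
  have hhx : h⁻¹ * x ∈ sGroup lam i := mul_mem (inv_mem hh) hx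
  have hY' : Y ∈ lSeq lam (i + 1) := hY
  have h1 := hκx _ (rightMulMap_mem_lSeq hY' hhx)
  rw [apply_rightMulMap_lSeq hY' hhx, coadjAct_apply, leftMulMap_rightMulMap,
    rightMulMap_rightMulMap, mul_assoc, mul_inv_cancel, mul_one, hκh, rightMulMap_rightMulMap,
    inv_mul_cancel, rightMulMap_one, leftMulMap_apply, map_add] at h1
  · simpa using h1
  · have hxY : leftMulMap F x Y ∈ sSeq lam i :=
      Submodule.add_mem _ hY.1 (sSeq_mul_mem lam i _ _ hx hY.1)
    exact Submodule.add_mem _ hxY (sSeq_mul_mem lam i _ _ hxY (inv_mem hh))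

/-! ### Conjugacy of the forms agreeing with λ on `lBar`, and the set Ξ_λ. -/

/-- The linear forms agreeing with `λ` on `lBar λ`. -/
def agreeSet (lam : Module.Dual F A) : Set (Module.Dual F A) :=
  {κ | ∀ Y ∈ lBar lam, κ Y = lam Y}

theorem agreeSet_lSeq {lam κ : Module.Dual F A} (hκ : κ ∈ agreeSet lam) {i : ℕ}
    (hi : i ≤ chainIndex lam) {Y : A} (hY : Y ∈ lSeq lam i) : κ Y = lam Y :=
  hκ Y (lSeq_monotone lam hi hY)

/-- Two forms in `agreeSet λ` are only conjugate under elements of `1 + sBar λ`. -/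
theorem mem_of_coadjAct_mem_agreeSet [FiniteDimensional F A] {lam κ : Module.Dual F A}
    {x : AlgGroup A} (hκ : κ ∈ agreeSet lam) (hκx : coadjAct κ x ∈ agreeSet lam) :
    x ∈ algSubgroup (sBar lam) := by
  have key : ∀ i ≤ chainIndex lam, x ∈ sGroup lam i := by
    intro i
    induction i with
    | zero => exact fun _ => mem_sGroup.2 Submodule.mem_top
    | succ i ih =>
      exact fun hi => mem_sGroup_succ (ih (by omega)) (fun Y hY => agreeSet_lSeq hκ hi hY)
        (fun Y hY => agreeSet_lSeq hκx hi hY)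
  exact key _ le_rfl

theorem leftMulMap_mem_lBar {lam : Module.Dual F A} {X : A} {g : AlgGroup A}
    (hX : X ∈ lBar lam) (hg : g ∈ algSubgroup (sBar lam)) : leftMulMap F g X ∈ lBar lam :=
  add_mem hX (sBar_mul_lBar_mem hg hX)

theorem rightMulMap_mem_lBar {lam : Module.Dual F A} {X : A} {g : AlgGroup A}
    (hX : X ∈ lBar lam) (hg : g ∈ algSubgroup (sBar lam)) : rightMulMap F g X ∈ lBar lam :=
  add_mem hX (lBar_mul_sBar_mem hX hg)

theorem apply_leftMulMap_lBar {lam : Module.Dual F A} {X : A} {g : AlgGroup A}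
    (hX : X ∈ lBar lam) (hg : g ∈ algSubgroup (sBar lam)) : lam (leftMulMap F g X) = lam X := by
  rw [leftMulMap_apply, map_add, apply_sBar_mul_lBar hg hX, add_zero]

theorem apply_rightMulMap_lBar {lam : Module.Dual F A} {X : A} {g : AlgGroup A}
    (hX : X ∈ lBar lam) (hg : g ∈ algSubgroup (sBar lam)) : lam (rightMulMap F g X) = lam X := by
  rw [rightMulMap_apply, map_add, apply_lBar_mul_sBar hX hg, add_zero]

/-- `lBar` is an ideal of `sBar`, and λ vanishes on the products of the two in either order, so λ on
`lBar` is unchanged by multiplication by 1 + `sBar` on either side. -/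
theorem coadjAct_mem_agreeSet {lam κ : Module.Dual F A} {x : AlgGroup A}
    (hκ : κ ∈ agreeSet lam) (hx : x ∈ algSubgroup (sBar lam)) :
    coadjAct κ x ∈ agreeSet lam := by
  intro Y hY
  have h1 := leftMulMap_mem_lBar hY hx
  rw [coadjAct_apply, hκ _ (rightMulMap_mem_lBar h1 (inv_mem hx)),
    apply_rightMulMap_lBar h1 (inv_mem hx), apply_leftMulMap_lBar hY hx]

/-- Forms in `agreeSet λ` with the same restriction to `sBar λ` are conjugate under
`1 + sBar λ`. -/
theorem exists_coadjAct_eq_of_eqOn_sBar [FiniteDimensional F A] {lam κ ν : Module.Dual F A}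
    (hκ : κ ∈ agreeSet lam) (h : ∀ X ∈ sBar lam, κ X = ν X) :
    ∃ g ∈ algSubgroup (sBar lam), coadjAct κ g = ν := by
  have key : ∀ i ≤ chainIndex lam, ∀ κ ∈ agreeSet lam, (∀ X ∈ sSeq lam i, κ X = ν X) →
      ∃ g ∈ algSubgroup (sBar lam), coadjAct κ g = ν := by
    intro i
    induction i with
    | zero =>
      exact fun _ κ _ h =>
        ⟨1, one_mem _, (coadjAct_one κ).trans (LinearMap.ext fun X => h X trivial)⟩
    | succ i ih =>
      intro hi κ hκ h
      have hκl : ∀ Y ∈ lSeq lam (i + 1), κ Y = lam Y := fun Y hY => agreeSet_lSeq hκ hi hY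
      obtain ⟨y, hy, hκy⟩ := exists_eq_apply_rightMulMap hκl
      -- The left kernel of κ(XY) on sⁱ × lⁱ⁺¹ lies in sⁱ⁺¹: replacing Y by Yy⁻¹ turns κ into λ.
      -- Since ν − κ vanishes there, it is κ(·W) on sⁱ.
      obtain ⟨W, hW, hWκ⟩ := exists_mem_eq_apply_mul κ (ν - κ) (sSeq lam i) (lSeq lam (i + 1)) <| by
        rintro X ⟨hX, hX0⟩
        refine sub_eq_zero.2 (h X ⟨hX, fun Y hY => ?_⟩).symm
        have hY' : Y ∈ lSeq lam (i + 1) := hY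
        have hY1 := rightMulMap_mem_lSeq hY' (inv_mem hy)
        have h1 := hX0 _ hY1
        rwa [hκy _ (sSeq_mul_mem lam i _ _ hX hY1.1), rightMulMap_mul, rightMulMap_rightMulMap,
          inv_mul_cancel, rightMulMap_one] at h1
      have hg : (AlgGroup.oneAdd W)⁻¹ ∈ lGroup lam (i + 1) := inv_mem hW
      have hgS : (AlgGroup.oneAdd W)⁻¹ ∈ algSubgroup (sBar lam) :=
        lBar_le_sBar (lSeq_monotone lam hi hg)
      -- Conjugating by u = (1 + W)⁻¹ turns κ into κ(uX(1 + W)). The part from u − 1 ∈ lⁱ⁺¹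
      -- contributes zero, leaving κ(X) + κ(XW) = ν(X) on sⁱ.
      obtain ⟨g, hgm, hg'⟩ := ih (by omega) _ (coadjAct_mem_agreeSet hκ hgS) fun X hX => by
        have hXW : rightMulMap F (AlgGroup.oneAdd W) X ∈ sSeq lam i :=
          Submodule.add_mem _ hX (sSeq_mul_mem lam i _ _ hX hW.1)
        rw [coadjAct_apply, inv_inv, ← leftMulMap_rightMulMap, leftMulMap_apply, map_add,
          hκl _ (lSeq_mul_sSeq_mem hg hXW), hg.2 _ hXW, add_zero, rightMulMap_apply, map_add,
          ← hWκ X hX]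
        simp
      exact ⟨_, mul_mem hgS hgm, by rw [← coadjAct_coadjAct, hg']⟩
  exact key _ le_rfl κ hκ h

/-- A form in `agreeSet λ` is on `sBar λ` a right translate of `λ`. -/
theorem exists_eqOn_rightMulMap [FiniteDimensional F A] {lam κ : Module.Dual F A}
    (hκ : κ ∈ agreeSet lam) :
    ∃ h ∈ algSubgroup (sBar lam), ∀ X ∈ sBar lam, κ X = lam (rightMulMap F h X) := by
  obtain ⟨W, hW, h⟩ := exists_mem_eq_apply_mul lam (κ - lam) (sBar lam).toSubmodule
    (sBar lam).toSubmodule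
    fun X hX => sub_eq_zero.2 (hκ X (mem_lBar_of_apply_mul hX.1 hX.2))
  refine ⟨.oneAdd W, hW, fun X hX => ?_⟩
  rw [rightMulMap_apply, map_add, ← h X hX]
  simp

theorem rightAct_mem_agreeSet {lam : Module.Dual F A} {s : AlgGroup A}
    (hs : s ∈ algSubgroup (sBar lam)) : rightAct lam s ∈ agreeSet lam :=
  fun _ hY => apply_rightMulMap_lBar hY (inv_mem hs)

/-- Left and right actions commute; hence Ξ_λ is the coadjoint saturation of the right translates
λs. -/
theorem rightAct_leftAct_eq_coadjAct (lam : Module.Dual F A) (g s : AlgGroup A) :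
    rightAct (rightAct (leftAct g lam) s) g⁻¹ = coadjAct (rightAct lam s) g⁻¹ := by
  ext X
  change lam (leftMulMap F g⁻¹ (rightMulMap F s⁻¹ (rightMulMap F g⁻¹⁻¹ X))) =
    lam (rightMulMap F s⁻¹ (rightMulMap F g⁻¹⁻¹ (leftMulMap F g⁻¹ X)))
  simp only [leftMulMap_rightMulMap]

/-- `Ξ_λ` is the saturation of `agreeSet λ` under the coadjoint action. -/
theorem mem_XiSet_iff [FiniteDimensional F A] {lam ν : Module.Dual F A} :
    ν ∈ XiSet lam ↔ ∃ g, coadjAct ν g ∈ agreeSet lam := by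
  constructor
  · rintro ⟨g, s, hs, rfl⟩
    refine ⟨g, ?_⟩
    rw [rightAct_leftAct_eq_coadjAct, coadjAct_coadjAct, inv_mul_cancel, coadjAct_one]
    exact rightAct_mem_agreeSet hs
  · rintro ⟨g, hg⟩
    obtain ⟨h, hh, hκ⟩ := exists_eqOn_rightMulMap hg
    -- The forms λh⁻¹ and ν^g agree only on `sBar`; conjugating by `t` makes them equal on A.
    obtain ⟨t, -, ht⟩ := exists_coadjAct_eq_of_eqOn_sBar
      (rightAct_mem_agreeSet (inv_mem hh)) fun X hX => by
        rw [hκ X hX]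
        change lam (rightMulMap F h⁻¹⁻¹ X) = _
        rw [inv_inv]
    refine ⟨(t * g⁻¹)⁻¹, h⁻¹, inv_mem hh, ?_⟩
    rw [rightAct_leftAct_eq_coadjAct, inv_inv, ← coadjAct_coadjAct, ht, coadjAct_coadjAct,
      mul_inv_cancel, coadjAct_one]

theorem coadjAct_mem_XiSet_iff [FiniteDimensional F A] {lam ν : Module.Dual F A}
    (g : AlgGroup A) : coadjAct ν g ∈ XiSet lam ↔ ν ∈ XiSet lam := by
  rw [mem_XiSet_iff, mem_XiSet_iff]
  constructor
  · rintro ⟨h, hh⟩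
    exact ⟨g * h, by rwa [← coadjAct_coadjAct]⟩
  · rintro ⟨h, hh⟩
    exact ⟨g⁻¹ * h, by rwa [coadjAct_coadjAct, mul_inv_cancel_left]⟩

theorem coadjOrbit_mem_coadjOrbitsIn_XiSet [FiniteDimensional F A] {lam ν : Module.Dual F A} :
    coadjOrbit ν ∈ coadjOrbitsIn (XiSet lam) ↔ ν ∈ XiSet lam := by
  constructor
  · exact fun h => h.2 (mem_coadjOrbit_self ν)
  · rintro h
    refine ⟨⟨ν, rfl⟩, ?_⟩
    rintro _ ⟨g, rfl⟩
    exact (coadjAct_mem_XiSet_iff g).2 h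

theorem coadjOrbitsIn_XiSet_eq_image [FiniteDimensional F A] (lam : Module.Dual F A) :
    coadjOrbitsIn (XiSet lam) = coadjOrbit '' agreeSet lam := by
  ext O
  constructor
  · rintro ⟨⟨ν, rfl⟩, h⟩
    obtain ⟨g, hg⟩ := mem_XiSet_iff.1 (h (mem_coadjOrbit_self ν))
    exact ⟨_, hg, coadjOrbit_coadjAct ν g⟩
  · rintro ⟨κ, hκ, rfl⟩
    exact coadjOrbit_mem_coadjOrbitsIn_XiSet.2 (mem_XiSet_iff.2 ⟨1, by rwa [coadjAct_one]⟩)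

/-! ### Restriction to `sBar` -/

/-- The inclusion `1 + h → 1 + A`. -/
def AlgGroup.incl (h : NonUnitalSubalgebra F A) : AlgGroup h →* AlgGroup A where
  toFun g := .oneAdd g.subOne
  map_one' := rfl
  map_mul' _ _ := rfl

theorem AlgGroup.incl_mem (h : NonUnitalSubalgebra F A) (g : AlgGroup h) :
    AlgGroup.incl h g ∈ algSubgroup h := g.subOne.2

theorem AlgGroup.exists_incl_eq {h : NonUnitalSubalgebra F A} {g : AlgGroup A}
    (hg : g ∈ algSubgroup h) : ∃ g', AlgGroup.incl h g' = g := ⟨.oneAdd ⟨g.subOne, hg⟩, rfl⟩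

theorem coadjAct_restrictForm (h : NonUnitalSubalgebra F A) (κ : Module.Dual F A)
    (g : AlgGroup h) :
    coadjAct (restrictForm κ h) g = restrictForm (coadjAct κ (AlgGroup.incl h g)) h := by
  ext X
  change _ = κ (rightMulMap F (AlgGroup.incl h g)⁻¹ (leftMulMap F (AlgGroup.incl h g) X))
  rw [← map_inv]
  rfl

theorem rightAct_restrictForm (h : NonUnitalSubalgebra F A) (κ : Module.Dual F A)
    (g : AlgGroup h) :
    rightAct (restrictForm κ h) g = restrictForm (rightAct κ (AlgGroup.incl h g)) h := by
  ext X
  change _ = κ (rightMulMap F (AlgGroup.incl h g)⁻¹ X)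
  rw [← map_inv]
  rfl

theorem rightOrbit_restrictForm_sBar [FiniteDimensional F A] (lam : Module.Dual F A) :
    rightOrbit (restrictForm lam (sBar lam)) =
      (fun κ => restrictForm κ (sBar lam)) '' agreeSet lam := by
  ext ν
  constructor
  · rintro ⟨g, rfl⟩
    exact ⟨_, rightAct_mem_agreeSet (AlgGroup.incl_mem _ g), (rightAct_restrictForm _ _ g).symm⟩
  · rintro ⟨κ, hκ, rfl⟩
    obtain ⟨h, hh, hκh⟩ := exists_eqOn_rightMulMap hκ
    obtain ⟨g, hg⟩ := AlgGroup.exists_incl_eq (inv_mem hh)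
    refine ⟨g, ?_⟩
    change rightAct (restrictForm lam (sBar lam)) g = _
    rw [rightAct_restrictForm, hg]
    ext X
    change lam (rightMulMap F h⁻¹⁻¹ X) = κ X
    rw [inv_inv, hκh X X.2]

theorem coadjOrbitsIn_rightOrbit_eq_image [FiniteDimensional F A] (lam : Module.Dual F A) :
    coadjOrbitsIn (rightOrbit (restrictForm lam (sBar lam))) =
      (fun κ => coadjOrbit (restrictForm κ (sBar lam))) '' agreeSet lam := by
  rw [rightOrbit_restrictForm_sBar]
  ext O
  constructor
  · rintro ⟨⟨ν, rfl⟩, h⟩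
    obtain ⟨κ, hκ, rfl⟩ := h (mem_coadjOrbit_self ν)
    exact ⟨κ, hκ, rfl⟩
  · rintro ⟨κ, hκ, rfl⟩
    refine ⟨⟨_, rfl⟩, ?_⟩
    rintro _ ⟨g, rfl⟩
    exact ⟨_, coadjAct_mem_agreeSet hκ (AlgGroup.incl_mem _ g),
      (coadjAct_restrictForm _ _ g).symm⟩

/-- Conjugate restrictions lift because equality on `sBar` already implies conjugacy; conversely,
any element conjugating κ to ν lies in 1 + `sBar`, so it acts on the restrictions. -/
theorem coadjOrbit_restrictForm_eq_iff [FiniteDimensional F A] {lam κ ν : Module.Dual F A}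
    (hκ : κ ∈ agreeSet lam) (hν : ν ∈ agreeSet lam) :
    coadjOrbit (restrictForm κ (sBar lam)) = coadjOrbit (restrictForm ν (sBar lam)) ↔
      coadjOrbit κ = coadjOrbit ν := by
  rw [coadjOrbit_eq_iff, coadjOrbit_eq_iff]
  constructor
  · rintro ⟨g, hg⟩
    rw [coadjAct_restrictForm] at hg
    obtain ⟨t, -, ht⟩ := exists_coadjAct_eq_of_eqOn_sBar
      (coadjAct_mem_agreeSet hκ (AlgGroup.incl_mem _ g))
      fun X hX => LinearMap.congr_fun hg ⟨X, hX⟩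
    exact ⟨_, by rw [← coadjAct_coadjAct, ht]⟩
  · rintro ⟨g, rfl⟩
    obtain ⟨g, rfl⟩ := AlgGroup.exists_incl_eq (mem_of_coadjAct_mem_agreeSet hκ hν)
    exact ⟨g, coadjAct_restrictForm _ _ g⟩

theorem Set.ncard_image_eq_of_forall_iff {α β γ : Type*} {s : Set α} {f : α → β} {g : α → γ}
    (h : ∀ x ∈ s, ∀ y ∈ s, f x = f y ↔ g x = g y) : (f '' s).ncard = (g '' s).ncard := by
  refine Set.ncard_congr (fun b hb => g hb.choose) (fun b hb => ⟨_, hb.choose_spec.1, rfl⟩) ?_ ?_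
  · intro b b' hb hb' hbb
    rw [← hb.choose_spec.2, ← hb'.choose_spec.2]
    exact (h _ hb.choose_spec.1 _ hb'.choose_spec.1).2 hbb
  · rintro _ ⟨x, hx, rfl⟩
    have hfx : f x ∈ f '' s := ⟨x, hx, rfl⟩
    exact ⟨f x, hfx, (h _ hfx.choose_spec.1 _ hx).1 hfx.choose_spec.2⟩

theorem ncard_coadjOrbitsIn_XiSet_eq [FiniteDimensional F A] (lam : Module.Dual F A) :
    (coadjOrbitsIn (XiSet lam)).ncard =
      (coadjOrbitsIn (rightOrbit (restrictForm lam (sBar lam)))).ncard := by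
  rw [coadjOrbitsIn_XiSet_eq_image, coadjOrbitsIn_rightOrbit_eq_image]
  exact Set.ncard_image_eq_of_forall_iff fun κ hκ ν hν =>
    (coadjOrbit_restrictForm_eq_iff hκ hν).symm

end Chains

/-! ### Isotypic parts and Frobenius reciprocity. -/

section Isotypic

/-- If the subgroup `S` normalizes `L` and fixes the linear character `χ` of `L`, then the
`χ`-isotypic part of a representation affords a representation of `S`. -/
theorem exists_isotypic_representation {G V : Type*} [Group G] [Finite G] [AddCommGroup V]
    [Module ℂ V] [FiniteDimensional ℂ V] (ρ : Representation ℂ G V) (L S : Subgroup G) [Fintype L]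
    (χ : G → ℂ) (hmul : ∀ l ∈ L, ∀ l' ∈ L, χ (l * l') = χ l * χ l')
    (hunit : ∀ l ∈ L, (starRingEnd ℂ) (χ l) * χ l = 1)
    (hnorm : ∀ s ∈ S, ∀ l ∈ L, s⁻¹ * l * s ∈ L ∧ χ (s⁻¹ * l * s) = χ l) :
    ∃ (W : Submodule ℂ V) (σ : Representation ℂ S W), ∀ s : S, σ.character s =
      (Nat.card L : ℂ)⁻¹ * ∑ l : L, (starRingEnd ℂ) (χ l) * ρ.character (l * s) := by
  let W : Submodule ℂ V :=
    { carrier := {v | ∀ l ∈ L, ρ l v = χ l • v}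
      zero_mem' := fun l _ => by simp
      add_mem' := fun {a b} ha hb l hl => by rw [map_add, ha l hl, hb l hl, smul_add]
      smul_mem' := fun c a ha l hl => by rw [map_smul, ha l hl, smul_comm] }
  have hW : ∀ s : S, ∀ v ∈ W, ρ s v ∈ W := by
    intro s v hv l hl
    obtain ⟨h1, h2⟩ := hnorm s s.2 l hl
    have h3 : l * (s : G) = (s : G) * ((s : G)⁻¹ * l * (s : G)) := by group
    rw [← Module.End.mul_apply, ← map_mul, h3, map_mul, Module.End.mul_apply, hv _ h1, h2,
      map_smul]
  let σ : Representation ℂ S W :=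
    { toFun := fun s => (ρ s).restrict (hW s)
      map_one' := by ext; simp
      map_mul' := fun x y => by ext; simp }
  -- The projector onto W. As ρ(s)e maps V into W and restricts to σ(s) there, its trace on V is the
  -- character of σ.
  let e : V →ₗ[ℂ] V := (Nat.card L : ℂ)⁻¹ • ∑ l : L, (starRingEnd ℂ) (χ l) • ρ l
  have he : ∀ v, e v = (Nat.card L : ℂ)⁻¹ • ∑ l : L, (starRingEnd ℂ) (χ l) • ρ l v := by
    intro v; simp [e, LinearMap.sum_apply]
  have heW : ∀ v, e v ∈ W := by
    intro v l hl
    rw [he, map_smul, map_sum, smul_comm (χ l)]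
    congr 1
    rw [Finset.smul_sum]
    refine Fintype.sum_equiv (Equiv.mulLeft (⟨l, hl⟩ : L)) _ _ fun l' => ?_
    have h1 : (((Equiv.mulLeft (⟨l, hl⟩ : L)) l' : L) : G) = l * l' := rfl
    rw [h1, map_smul, hmul l hl l' l'.2, smul_smul, map_mul, map_mul, Module.End.mul_apply,
      ← mul_assoc, mul_comm (χ l), hunit l hl, one_mul]
  have heid : ∀ v ∈ W, e v = v := by
    intro v hv
    have h1 : ∀ l : L, (starRingEnd ℂ) (χ l) • ρ l v = v := fun l => by
      rw [hv l l.2, smul_smul, hunit l l.2, one_smul]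
    rw [he]
    simp only [h1, Finset.sum_const, Finset.card_univ]
    rw [← Nat.card_eq_fintype_card, ← Nat.cast_smul_eq_nsmul ℂ, smul_smul, inv_mul_cancel₀,
      one_smul]
    exact_mod_cast Nat.card_pos.ne'
  refine ⟨W, σ, fun s => ?_⟩
  have hmem : ∀ v, (ρ s * e) v ∈ W := fun v => hW s _ (heW v)
  have hres : σ s = (ρ s * e).restrict (fun x _ => hmem x) := by
    ext v
    change ρ s v = ρ s (e v)
    rw [heid v v.2]
  rw [Representation.character, hres, LinearMap.trace_restrict_eq_of_forall_mem W _ hmem]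
  simp only [e, Algebra.mul_smul_comm, Finset.mul_sum, map_smul, map_sum, smul_eq_mul,
    ← map_mul]
  refine Finset.sum_congr rfl fun l _ => ?_
  rw [Representation.char_mul_comm]
  rfl

/-- Frobenius reciprocity. -/
theorem charInner_inducedFun {G : Type*} [Group G] [Finite G] (H : Subgroup G) [Fintype H]
    (χ ψ : G → ℂ) (hψ : ∀ x y, ψ (x * y * x⁻¹) = ψ y) :
    charInner (inducedFun H χ) ψ =
      (Nat.card H : ℂ)⁻¹ * ∑ h : H, χ h * (starRingEnd ℂ) (ψ h) := by
  classical
  have := Fintype.ofFinite G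
  have hG : (Nat.card G : ℂ) ≠ 0 := by simp
  have h1 : ∀ g, inducedFun H χ g =
      (Nat.card H : ℂ)⁻¹ * ∑ x : G, (H : Set G).indicator χ (x * g * x⁻¹) := by
    intro g
    rw [inducedFun, finsum_eq_sum_of_fintype]
    simp only [finsum_eq_if, Set.indicator_apply, SetLike.mem_coe]
  have h2 : ∀ x : G, ∑ g : G, (H : Set G).indicator χ (x * g * x⁻¹) * (starRingEnd ℂ) (ψ g) =
      ∑ h : H, χ h * (starRingEnd ℂ) (ψ h) := by
    -- Substituting x g x⁻¹ for g shows that every x contributes the same sum, as ψ is a class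
    -- function.
    intro x
    rw [Fintype.sum_equiv (MulAut.conj x).toEquiv _
      (fun g => (H : Set G).indicator χ g * (starRingEnd ℂ) (ψ g)) (fun g => by simp [hψ])]
    simp only [Set.indicator_apply, SetLike.mem_coe, ite_mul, zero_mul]
    rw [← Finset.sum_filter]
    exact Finset.sum_subtype _ (by simp) _
  rw [charInner_eq_sum]
  simp only [h1, mul_assoc (Nat.card H : ℂ)⁻¹, Finset.sum_mul]
  rw [← Finset.mul_sum, Finset.sum_comm]
  simp only [h2, Finset.sum_const, Finset.card_univ, nsmul_eq_mul]
  rw [← Nat.card_eq_fintype_card]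
  field_simp

end Isotypic

/-! ### Orthogonality of additive characters on a finite vector space. -/

section Fourier

variable {F V : Type*} [Field F] [Finite F] [AddCommGroup V] [Module F V]

theorem sum_addChar_linearForm [Fintype V] (θ : AddChar F ℂ) (hθ : θ ≠ 1) (η : Module.Dual F V)
    [Decidable (η = 0)] : ∑ X : V, θ (η X) = if η = 0 then (Nat.card V : ℂ) else 0 := by
  classical
  have h := AddChar.sum_eq_ite (θ.compAddMonoidHom η.toAddMonoidHom)
  have h1 : θ.compAddMonoidHom η.toAddMonoidHom = 0 ↔ η = 0 := by
    constructor
    · intro h0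
      by_contra hη
      obtain ⟨X, hX⟩ : ∃ X, η X ≠ 0 := by
        by_contra! hcon; exact hη (LinearMap.ext hcon)
      apply hθ
      ext t
      -- A nonzero linear form takes every value t, so θ would be trivial.
      have h2 := DFunLike.congr_fun h0 ((t * (η X)⁻¹) • X)
      simpa [hX] using h2
    · rintro rfl
      ext; simp
  simp only [h1] at h
  rw [Nat.card_eq_fintype_card]
  simpa using h

theorem sum_addChar_eval [FiniteDimensional F V] [Fintype (Module.Dual F V)] (θ : AddChar F ℂ)
    (hθ : θ ≠ 1) (X : V) [Decidable (X = 0)] :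
    ∑ κ : Module.Dual F V, θ (κ X) = if X = 0 then (Nat.card V : ℂ) else 0 := by
  classical
  have h := sum_addChar_linearForm θ hθ (Module.Dual.eval F V X)
  have h1 : Module.Dual.eval F V X = 0 ↔ X = 0 :=
    (Module.eval_apply_eq_zero_iff F X)
  have h2 : Nat.card (Module.Dual F V) = Nat.card V := by
    rw [Module.natCard_eq_pow_finrank (K := F), Module.natCard_eq_pow_finrank (K := F) (V := V),
      Subspace.dual_finrank_eq]
  simp only [h1, h2, Module.Dual.eval_apply] at h
  exact h

end Fourier

/-! ### Fourier analysis on 1 + A. -/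

section AlgebraGroupFourier

variable {F A : Type*} [Field F] [Finite F] [NonUnitalRing A] [Module F A]
  [IsScalarTower F A A] [SMulCommClass F A A] [FiniteDimensional F A]

/-- The underlying bijection `1 + A ≃ A`. -/
def AlgGroup.equiv (A : Type*) : AlgGroup A ≃ A :=
  ⟨AlgGroup.subOne, .oneAdd, fun _ => rfl, fun _ => rfl⟩

theorem AlgGroup.finite (F A : Type*) [Field F] [Finite F] [NonUnitalRing A] [Module F A]
    [FiniteDimensional F A] : Finite (AlgGroup A) :=
  have := Module.finite_of_finite F (M := A)
  Finite.of_equiv A (AlgGroup.equiv A).symm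

variable (F A) in
theorem Module.Dual.finite_of_finite : Finite (Module.Dual F A) :=
  Module.finite_of_finite F

theorem thetaFun_mul_conj (θ : AddChar F ℂ) (κ ν : Module.Dual F A) (x y : AlgGroup A) :
    thetaFun θ κ x * (starRingEnd ℂ) (thetaFun θ ν y) = θ (κ x.subOne - ν y.subOne) := by
  rw [thetaFun, thetaFun, sub_eq_add_neg, AddChar.map_add_eq_mul, AddChar.map_neg_eq_conj]

variable [IsNilpotentAlg A]

/-- θ_κ need not be a homomorphism on 1 + A; orthonormality uses only the additive structure carried
over by g ↦ g − 1. -/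
theorem charInner_thetaFun (θ : AddChar F ℂ) (hθ : θ ≠ 1) (κ ν : Module.Dual F A)
    [Decidable (κ = ν)] :
    charInner (thetaFun θ κ) (thetaFun θ ν) = if κ = ν then 1 else 0 := by
  classical
  have := AlgGroup.finite F A
  have := Fintype.ofFinite (AlgGroup A)
  have := Module.finite_of_finite F (M := A)
  have := Fintype.ofFinite A
  have hA : (Nat.card A : ℂ) ≠ 0 := by simp
  rw [charInner_eq_sum, Nat.card_congr (AlgGroup.equiv A)]
  simp only [thetaFun_mul_conj, ← LinearMap.sub_apply]
  rw [Fintype.sum_equiv (AlgGroup.equiv A) (fun x => θ ((κ - ν) x.subOne))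
    (fun X => θ ((κ - ν) X)) (fun x => rfl), sum_addChar_linearForm θ hθ]
  simp only [sub_eq_zero]
  split_ifs
  · exact inv_mul_cancel₀ hA
  · simp

/-- The Fourier coefficients of a function on `1 + A`. -/
def dualCoeff (θ : AddChar F ℂ) : (AlgGroup A → ℂ) →ₗ[ℂ] (Module.Dual F A → ℂ) :=
  have := AlgGroup.finite F A
  LinearMap.pi fun κ => charInnerLeft (thetaFun θ κ)

theorem dualCoeff_apply (θ : AddChar F ℂ) (f : AlgGroup A → ℂ) (κ : Module.Dual F A) :
    dualCoeff θ f κ = charInner f (thetaFun θ κ) := rfl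

/-- The function on `1 + A` with given Fourier coefficients. -/
def dualSynth (θ : AddChar F ℂ) [Fintype (Module.Dual F A)] :
    (Module.Dual F A → ℂ) →ₗ[ℂ] (AlgGroup A → ℂ) :=
  Fintype.linearCombination ℂ (thetaFun θ)

variable [Fintype (Module.Dual F A)]

theorem dualSynth_apply (θ : AddChar F ℂ) (c : Module.Dual F A → ℂ) (x : AlgGroup A) :
    dualSynth θ c x = ∑ κ, c κ * thetaFun θ κ x := by
  simp [dualSynth, Fintype.linearCombination_apply]

theorem dualCoeff_dualSynth (θ : AddChar F ℂ) (hθ : θ ≠ 1) (c : Module.Dual F A → ℂ) :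
    dualCoeff θ (dualSynth θ c) = c := by
  classical
  have := AlgGroup.finite F A
  funext κ
  rw [dualCoeff_apply, ← charInnerLeft_apply, dualSynth, Fintype.linearCombination_apply,
    map_sum]
  simp [charInnerLeft_apply, charInner_thetaFun θ hθ]

theorem dualSynth_dualCoeff (θ : AddChar F ℂ) (hθ : θ ≠ 1) (f : AlgGroup A → ℂ) :
    dualSynth θ (dualCoeff θ f) = f := by
  classical
  have := AlgGroup.finite F A
  have := Fintype.ofFinite (AlgGroup A)
  have hG : (Nat.card (AlgGroup A) : ℂ) ≠ 0 := by simp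
  funext x
  have h1 : ∀ y, ∑ κ, thetaFun θ κ x * (starRingEnd ℂ) (thetaFun θ κ y) =
      if y = x then (Nat.card (AlgGroup A) : ℂ) else 0 := by
    intro y
    simp only [thetaFun_mul_conj, ← map_sub]
    rw [sum_addChar_eval θ hθ, Nat.card_congr (AlgGroup.equiv A)]
    simp only [sub_eq_zero, AlgGroup.ext_iff, eq_comm]
  simp only [dualSynth_apply, dualCoeff_apply, charInner_eq_sum, Finset.mul_sum,
    Finset.sum_mul]
  rw [Finset.sum_comm]
  have h2 : ∀ y, ∑ κ, (Nat.card (AlgGroup A) : ℂ)⁻¹ *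
      (f y * (starRingEnd ℂ) (thetaFun θ κ y)) * thetaFun θ κ x =
      (Nat.card (AlgGroup A) : ℂ)⁻¹ * f y * if y = x then (Nat.card (AlgGroup A) : ℂ) else 0 := by
    intro y
    rw [← h1, Finset.mul_sum]
    refine Finset.sum_congr rfl fun κ _ => by ring
  simp only [h2, mul_ite, mul_zero, Finset.sum_ite_eq', Finset.mem_univ, if_true]
  field_simp

/-- Parseval's identity. -/
theorem charInner_dualSynth (θ : AddChar F ℂ) (hθ : θ ≠ 1) (c : Module.Dual F A → ℂ) :
    charInner (dualSynth θ c) (dualSynth θ c) = ∑ κ, ((‖c κ‖ ^ 2 : ℝ) : ℂ) := by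
  have := AlgGroup.finite F A
  have := Fintype.ofFinite (AlgGroup A)
  have h : ∀ f : AlgGroup A → ℂ, charInner f (dualSynth θ c) =
      ∑ κ, dualCoeff θ f κ * (starRingEnd ℂ) (c κ) := by
    intro f
    simp only [dualCoeff_apply, charInner_eq_sum, dualSynth_apply θ c, map_sum, map_mul,
      Finset.mul_sum, Finset.sum_mul]
    rw [Finset.sum_comm]
    exact Finset.sum_congr rfl fun κ _ => Finset.sum_congr rfl fun x _ => by ring
  rw [h, dualCoeff_dualSynth θ hθ]
  simp only [Complex.mul_conj, Complex.normSq_eq_norm_sq]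

theorem subOne_conj (g x : AlgGroup A) :
    (g * x * g⁻¹).subOne = rightMulMap F g⁻¹ (leftMulMap F g x.subOne) := by
  have h : g.subOne + g⁻¹.subOne + g.subOne * g⁻¹.subOne = 0 := by
    rw [← AlgGroup.subOne_mul, mul_inv_cancel, AlgGroup.subOne_one]
  simp only [AlgGroup.subOne_mul, rightMulMap_apply, leftMulMap_apply, add_mul]
  rw [← sub_eq_zero, ← h]
  abel

theorem thetaFun_coadjAct (θ : AddChar F ℂ) (κ : Module.Dual F A) (g x : AlgGroup A) :
    thetaFun θ (coadjAct κ g) x = thetaFun θ κ (g * x * g⁻¹) := by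
  rw [thetaFun, thetaFun, subOne_conj (F := F), coadjAct_apply]

/-- With its converse `dualSynth_conj`, this identifies class functions with functions on the set of
coadjoint orbits. -/
theorem dualCoeff_coadjAct (θ : AddChar F ℂ) {f : AlgGroup A → ℂ}
    (hf : ∀ x y, f (x * y * x⁻¹) = f y) (κ : Module.Dual F A) (g : AlgGroup A) :
    dualCoeff θ f (coadjAct κ g) = dualCoeff θ f κ := by
  have := AlgGroup.finite F A
  have := Fintype.ofFinite (AlgGroup A)
  rw [dualCoeff_apply, dualCoeff_apply, charInner_eq_sum, charInner_eq_sum]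
  congr 1
  exact Fintype.sum_equiv (MulAut.conj g).toEquiv _ _ fun x => by
    simp [thetaFun_coadjAct, hf]

/-- The coadjoint action of an element, as a permutation. -/
def coadjPerm (g : AlgGroup A) : Equiv.Perm (Module.Dual F A) where
  toFun κ := coadjAct κ g
  invFun κ := coadjAct κ g⁻¹
  left_inv κ := by beta_reduce; rw [coadjAct_coadjAct, mul_inv_cancel, coadjAct_one]
  right_inv κ := by beta_reduce; rw [coadjAct_coadjAct, inv_mul_cancel, coadjAct_one]

theorem dualSynth_conj (θ : AddChar F ℂ) {c : Module.Dual F A → ℂ}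
    (hc : ∀ κ g, c (coadjAct κ g) = c κ) (g x : AlgGroup A) :
    dualSynth θ c (g * x * g⁻¹) = dualSynth θ c x := by
  rw [dualSynth_apply, dualSynth_apply]
  exact Fintype.sum_equiv (coadjPerm g) _ _ fun κ => by
    simp [coadjPerm, hc, thetaFun_coadjAct]

end AlgebraGroupFourier

/-! ### The dichotomy for irreducible characters and the count of constituents. -/

section Constituents

variable {F A : Type*} [Field F] [Finite F] [NonUnitalRing A] [Module F A]
  [IsScalarTower F A A] [SMulCommClass F A A] [FiniteDimensional F A] [IsNilpotentAlg A]
  [Fintype (Module.Dual F A)]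

theorem sum_indicator_const {α : Type*} [Fintype α] (s : Set α) (c : ℂ) :
    ∑ x, s.indicator (fun _ => c) x = Nat.card s * c := by
  classical
  simp only [Set.indicator_apply]
  rw [← Finset.sum_filter, Finset.sum_const, nsmul_eq_mul, Nat.card_eq_fintype_card,
    Fintype.card_subtype]

/-- Sum w(κ) over pairs (x, κ) with κ^x ∈ `agreeSet lam` in both orders: for fixed κ ∈ Ξ_λ these x
form a left coset of 1 + `sBar`. -/
theorem card_mul_sum_indicator_XiSet (lam : Module.Dual F A) {w : Module.Dual F A → ℂ}
    (hw : ∀ κ g, w (coadjAct κ g) = w κ) :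
    (Nat.card (algSubgroup (sBar lam)) : ℂ) * ∑ κ, (XiSet lam).indicator w κ =
      Nat.card (AlgGroup A) * ∑ κ, (agreeSet lam).indicator w κ := by
  classical
  have := AlgGroup.finite F A
  have := Fintype.ofFinite (AlgGroup A)
  have h1 : ∑ x : AlgGroup A, ∑ κ, (agreeSet lam).indicator w (coadjAct κ x) =
      Nat.card (AlgGroup A) * ∑ κ, (agreeSet lam).indicator w κ := by
    have : ∀ x : AlgGroup A, ∑ κ, (agreeSet lam).indicator w (coadjAct κ x) =
        ∑ κ, (agreeSet lam).indicator w κ := fun x =>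
      Fintype.sum_equiv (coadjPerm x) _ _ fun κ => rfl
    simp only [this, Finset.sum_const, Finset.card_univ, nsmul_eq_mul, Nat.card_eq_fintype_card]
  rw [← h1, Finset.sum_comm, Finset.mul_sum]
  refine Finset.sum_congr rfl fun κ _ => ?_
  by_cases hκ : κ ∈ XiSet lam
  · obtain ⟨g, hg⟩ := mem_XiSet_iff.1 hκ
    rw [Set.indicator_of_mem hκ]
    rw [Fintype.sum_equiv (Equiv.mulLeft g⁻¹)
      (fun x => (agreeSet lam).indicator w (coadjAct κ x))
      (fun y => (algSubgroup (sBar lam) : Set (AlgGroup A)).indicator (fun _ => w κ) y)]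
    · exact (sum_indicator_const _ _).symm
    · intro x
      have hx : coadjAct κ x = coadjAct (coadjAct κ g) (g⁻¹ * x) := by
        rw [coadjAct_coadjAct, mul_inv_cancel_left]
      by_cases hS : g⁻¹ * x ∈ algSubgroup (sBar lam)
      · rw [Set.indicator_of_mem (by rw [hx]; exact coadjAct_mem_agreeSet hg hS),
          Set.indicator_of_mem (by exact hS), hw]
      · rw [Set.indicator_of_notMem
          (fun h => hS (mem_of_coadjAct_mem_agreeSet hg (hx ▸ h))), Set.indicator_of_notMem
          (by exact hS)]
  · rw [Set.indicator_of_notMem hκ, mul_zero]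
    refine (Finset.sum_eq_zero fun x _ => Set.indicator_of_notMem (fun h => hκ ?_) _).symm
    exact mem_XiSet_iff.2 ⟨x, h⟩

/-- Translation by a form η' vanishing on `sBar` moves each κ in `agreeSet lam` within its orbit, so
it preserves the coefficients and multiplies the value at x by θ(η'(x − 1)), which can be made
different from 1. -/
theorem dualSynth_indicator_of_notMem (θ : AddChar F ℂ) (hθ : θ ≠ 1) (lam : Module.Dual F A)
    {c : Module.Dual F A → ℂ} (hc : ∀ κ g, c (coadjAct κ g) = c κ) {x : AlgGroup A}
    (hx : x ∉ algSubgroup (sBar lam)) : dualSynth θ ((agreeSet lam).indicator c) x = 0 := by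
  obtain ⟨η, hη, hηs⟩ := Submodule.exists_le_ker_of_notMem (p := (sBar lam).toSubmodule)
    (v := x.subOne) hx
  obtain ⟨t, ht⟩ := AddChar.ne_one_iff.1 hθ
  let η' : Module.Dual F A := (t * (η x.subOne)⁻¹) • η
  have hη' : η' x.subOne = t := by simp [η', hη]
  have hs : ∀ X ∈ sBar lam, η' X = 0 := fun X hX => by
    have : η X = 0 := hηs hX
    simp [η', this]
  have hadd : ∀ κ ∈ agreeSet lam, κ + η' ∈ agreeSet lam ∧ c (κ + η') = c κ := by
    intro κ hκ
    obtain ⟨g, hg, hgκ⟩ := exists_coadjAct_eq_of_eqOn_sBar (ν := κ + η') hκ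
      fun X hX => by simp [hs X hX]
    rw [← hgκ]
    exact ⟨coadjAct_mem_agreeSet hκ hg, hc κ g⟩
  have hind : ∀ κ, (agreeSet lam).indicator c (κ + η') = (agreeSet lam).indicator c κ := by
    intro κ
    by_cases hκ : κ ∈ agreeSet lam
    · rw [Set.indicator_of_mem hκ, Set.indicator_of_mem (hadd κ hκ).1, (hadd κ hκ).2]
    · rw [Set.indicator_of_notMem hκ, Set.indicator_of_notMem]
      intro h
      apply hκ
      intro Y hY
      have h1 := h Y hY
      rwa [LinearMap.add_apply, hs Y (lBar_le_sBar hY), add_zero] at h1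
  have h2 : dualSynth θ ((agreeSet lam).indicator c) x =
      θ t * dualSynth θ ((agreeSet lam).indicator c) x := by
    rw [dualSynth_apply, Finset.mul_sum]
    refine (Fintype.sum_equiv (Equiv.addRight η') _ _ fun κ => ?_).symm
    rw [Equiv.coe_addRight, hind, thetaFun, thetaFun, LinearMap.add_apply, hη',
      AddChar.map_add_eq_mul]
    ring
  by_contra h0
  exact ht (mul_right_cancel₀ h0 (by rw [one_mul]; exact h2.symm))

theorem thetaFun_mul_lBar (θ : AddChar F ℂ) {lam : Module.Dual F A} {l l' : AlgGroup A}
    (hl : l ∈ algSubgroup (lBar lam)) (hl' : l' ∈ algSubgroup (lBar lam)) :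
    thetaFun θ lam (l * l') = thetaFun θ lam l * thetaFun θ lam l' := by
  rw [thetaFun, AlgGroup.subOne_mul, map_add, apply_lBar_mul_sBar hl (lBar_le_sBar hl'), add_zero,
    map_add, AddChar.map_add_eq_mul, thetaFun, thetaFun]

theorem thetaFun_conj_lBar (θ : AddChar F ℂ) {lam : Module.Dual F A} {s l : AlgGroup A}
    (hs : s ∈ algSubgroup (sBar lam)) (hl : l ∈ algSubgroup (lBar lam)) :
    s⁻¹ * l * s ∈ algSubgroup (lBar lam) ∧
      thetaFun θ lam (s⁻¹ * l * s) = thetaFun θ lam l := by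
  have h1 := subOne_conj (F := F) s⁻¹ l
  rw [inv_inv] at h1
  have h2 := leftMulMap_mem_lBar hl (inv_mem hs)
  refine ⟨?_, ?_⟩
  · rw [mem_algSubgroup, h1]
    exact rightMulMap_mem_lBar h2 hs
  · rw [thetaFun, h1, apply_rightMulMap_lBar h2 hs, apply_leftMulMap_lBar hl (inv_mem hs), thetaFun]

/-- Up to the factor θ_κ(s), this averages θ over the form Y ↦ κ(Ys) − λ(Y) on `lBar`. That form is
zero exactly when κ agrees with λ there, because right multiplication by s permutes `lBar` and
preserves λ. -/
theorem average_thetaFun (θ : AddChar F ℂ) (hθ : θ ≠ 1) (lam κ : Module.Dual F A)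
    [Fintype (algSubgroup (lBar lam))] {s : AlgGroup A} (hs : s ∈ algSubgroup (sBar lam)) :
    (Nat.card (algSubgroup (lBar lam)) : ℂ)⁻¹ * ∑ l : algSubgroup (lBar lam),
      (starRingEnd ℂ) (thetaFun θ lam l) * thetaFun θ κ (l * s) =
      (agreeSet lam).indicator (fun κ => thetaFun θ κ s) κ := by
  classical
  have : Finite A := Module.finite_of_finite F
  have := Fintype.ofFinite (lBar lam)
  let e : algSubgroup (lBar lam) ≃ lBar lam :=
    ⟨fun g => ⟨g.1.subOne, g.2⟩, fun X => ⟨.oneAdd X, X.2⟩, fun _ => rfl, fun _ => rfl⟩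
  let η : Module.Dual F (lBar lam) := restrictForm (κ ∘ₗ rightMulMap F s - lam) (lBar lam)
  have h1 : ∀ l : algSubgroup (lBar lam),
      (starRingEnd ℂ) (thetaFun θ lam l) * thetaFun θ κ (l * s) =
        thetaFun θ κ s * θ (η (e l)) := by
    intro l
    have : η (e l) = κ l.1.subOne + κ (l.1.subOne * s.subOne) - lam l.1.subOne := by
      change κ (l.1.subOne + l.1.subOne * s.subOne) - lam l.1.subOne = _
      rw [map_add]
    rw [mul_comm, thetaFun_mul_conj, this, thetaFun, ← AddChar.map_add_eq_mul,
      AlgGroup.subOne_mul, map_add, map_add]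
    congr 1
    abel
  have h2 : η = 0 ↔ κ ∈ agreeSet lam := by
    have hη : η = 0 ↔ ∀ Y ∈ lBar lam, κ (rightMulMap F s Y) = lam Y := by
      constructor
      · exact fun h Y hY => sub_eq_zero.1 (LinearMap.congr_fun h ⟨Y, hY⟩)
      · exact fun h => LinearMap.ext fun Y => sub_eq_zero.2 (h Y Y.2)
    rw [hη]
    constructor
    · intro h Y hY
      have h3 := h _ (rightMulMap_mem_lBar hY (inv_mem hs))
      rwa [rightMulMap_rightMulMap, inv_mul_cancel, rightMulMap_one,
        apply_rightMulMap_lBar hY (inv_mem hs)] at h3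
    · intro h Y hY
      rw [h _ (rightMulMap_mem_lBar hY hs), apply_rightMulMap_lBar hY hs]
  simp only [h1]
  rw [← Finset.mul_sum, Fintype.sum_equiv e (fun l => θ (η (e l))) (fun Y => θ (η Y))
    (fun _ => rfl), sum_addChar_linearForm θ hθ, Nat.card_congr e, Set.indicator_apply]
  simp only [h2]
  have hc : (Nat.card (lBar lam) : ℂ) ≠ 0 := by simp
  split_ifs
  · field_simp
  · simp

/-- On 1 + `sBar`, cutting the coefficients down to `agreeSet lam` is averaging against θ_λ over 1 +
`lBar`. For a character f this is the formula of `exists_isotypic_representation`. -/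
theorem dualSynth_indicator_of_mem (θ : AddChar F ℂ) (hθ : θ ≠ 1) (lam : Module.Dual F A)
    [Fintype (algSubgroup (lBar lam))] (f : AlgGroup A → ℂ) {s : AlgGroup A}
    (hs : s ∈ algSubgroup (sBar lam)) :
    dualSynth θ ((agreeSet lam).indicator (dualCoeff θ f)) s =
      (Nat.card (algSubgroup (lBar lam)) : ℂ)⁻¹ * ∑ l : algSubgroup (lBar lam),
        (starRingEnd ℂ) (thetaFun θ lam l) * f (l * s) := by
  conv_rhs => rw [← dualSynth_dualCoeff θ hθ f]
  simp only [dualSynth_apply, Finset.mul_sum]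
  rw [Finset.sum_comm]
  refine Finset.sum_congr rfl fun κ _ => ?_
  have h := average_thetaFun θ hθ lam κ hs
  have h3 : (agreeSet lam).indicator (dualCoeff θ f) κ * thetaFun θ κ s =
      dualCoeff θ f κ * (agreeSet lam).indicator (fun κ => thetaFun θ κ s) κ := by
    by_cases hκ : κ ∈ agreeSet lam
    · rw [Set.indicator_of_mem hκ, Set.indicator_of_mem hκ]
    · rw [Set.indicator_of_notMem hκ, Set.indicator_of_notMem hκ, zero_mul, mul_zero]
  rw [h3, ← h, Finset.mul_sum, Finset.mul_sum]
  refine Finset.sum_congr rfl fun l _ => by ring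

open scoped ComplexOrder in
/-- The Fourier coefficients of an irreducible character are supported on `Ξ_λ` if it is a
constituent of `ξ_λ`, and on the complement of `Ξ_λ` otherwise. -/
theorem dualCoeff_irr (θ : AddChar F ℂ) (hθ : θ ≠ 1) (lam : Module.Dual F A)
    {ψ : AlgGroup A → ℂ} (hψ : ψ ∈ irrCharacters (AlgGroup A)) :
    (ψ ∈ irrConstituents (xiChar θ lam) ∧ ∀ κ ∉ XiSet lam, dualCoeff θ ψ κ = 0) ∨
    (ψ ∉ irrConstituents (xiChar θ lam) ∧ ∀ κ ∈ XiSet lam, dualCoeff θ ψ κ = 0) := by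
  classical
  have := AlgGroup.finite F A
  have := Fintype.ofFinite (AlgGroup A)
  have hψ1 := charInner_irr_self hψ
  have hψm := hψ
  obtain ⟨d, ρ, -, hρ⟩ := hψ
  have hcl : ∀ x y, ψ (x * y * x⁻¹) = ψ y := fun x y => by rw [← hρ, Representation.char_conj]
  set a := dualCoeff θ ψ with ha
  have hainv : ∀ κ g, a (coadjAct κ g) = a κ := dualCoeff_coadjAct θ hcl
  obtain ⟨W, σ, hσ⟩ := exists_isotypic_representation ρ (algSubgroup (lBar lam))
    (algSubgroup (sBar lam)) (thetaFun θ lam) (fun l hl l' hl' => thetaFun_mul_lBar θ hl hl')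
    (fun l _ => by rw [mul_comm, thetaFun_mul_conj, sub_self, AddChar.map_zero_eq_one])
    (fun s hs l hl => thetaFun_conj_lBar θ hs hl)
  set f := dualSynth θ ((agreeSet lam).indicator a) with hf
  have hfσ : ∀ s : algSubgroup (sBar lam), f s = σ.character s := fun s => by
    rw [hσ, hf, ha, dualSynth_indicator_of_mem θ hθ lam ψ s.2, hρ]
  -- the multiplicity of `ψ`
  have hmult : charInner (xiChar θ lam) ψ = (Module.finrank ℂ W : ℂ) := by
    have h := congrArg (starRingEnd ℂ) (Representation.char_one σ)
    rw [hσ, map_natCast] at h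
    rw [xiChar, charInner_inducedFun _ _ _ hcl, ← h, hρ]
    simp
  -- the norm of the projection of `ψ`
  obtain ⟨n, hn⟩ := charInner_character_self σ
  have hS : (Nat.card (algSubgroup (sBar lam)) : ℂ) ≠ 0 := by simp
  have hG : (Nat.card (AlgGroup A) : ℂ) ≠ 0 := by simp
  have hnorm : ∑ κ, (XiSet lam).indicator (fun κ => ((‖a κ‖ ^ 2 : ℝ) : ℂ)) κ = n := by
    have h1 := card_mul_sum_indicator_XiSet lam (w := fun κ => ((‖a κ‖ ^ 2 : ℝ) : ℂ))
      (fun κ g => by rw [hainv])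
    have h2 := charInner_dualSynth θ hθ ((agreeSet lam).indicator a)
    have h3 : ∀ κ, ((‖(agreeSet lam).indicator a κ‖ ^ 2 : ℝ) : ℂ) =
        (agreeSet lam).indicator (fun κ => ((‖a κ‖ ^ 2 : ℝ) : ℂ)) κ := by
      intro κ
      by_cases hκ : κ ∈ agreeSet lam
      · simp only [Set.indicator_of_mem hκ]
      · simp [Set.indicator_of_notMem hκ]
    simp only [h3] at h2
    rw [← h2, ← hf, charInner_eq_sum, mul_inv_cancel_left₀ hG] at h1
    rw [charInner_eq_sum] at hn
    have h4 : ∑ x, f x * (starRingEnd ℂ) (f x) =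
        ∑ s : algSubgroup (sBar lam), σ.character s * (starRingEnd ℂ) (σ.character s) := by
      rw [← Finset.sum_subset (Finset.subset_univ
        (Finset.univ.filter (· ∈ algSubgroup (sBar lam))))]
      · rw [Finset.sum_subtype _ (p := (· ∈ algSubgroup (sBar lam))) (by simp)]
        exact Finset.sum_congr rfl fun s _ => by rw [hfσ]
      · intro x _ hx
        rw [hf, dualSynth_indicator_of_notMem θ hθ lam hainv (by simpa using hx), zero_mul]
    rw [h4] at h1
    rw [← hn, ← h1, inv_mul_cancel_left₀ hS]
  have htot : ∑ κ, ((‖a κ‖ ^ 2 : ℝ) : ℂ) = 1 := by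
    rw [← charInner_dualSynth θ hθ, ha, dualSynth_dualCoeff θ hθ, hψ1]
  have hsplit : ∑ κ, (XiSet lam).indicator (fun κ => ‖a κ‖ ^ 2) κ +
      ∑ κ, (XiSet lam)ᶜ.indicator (fun κ => ‖a κ‖ ^ 2) κ = 1 := by
    rw [← Finset.sum_add_distrib]
    simp only [Set.indicator_self_add_compl_apply]
    exact_mod_cast htot
  have hnorm' : ∑ κ, (XiSet lam).indicator (fun κ => ‖a κ‖ ^ 2) κ = n := by
    have h1 : ∀ κ, (XiSet lam).indicator (fun κ => ((‖a κ‖ ^ 2 : ℝ) : ℂ)) κ =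
        (((XiSet lam).indicator (fun κ => ‖a κ‖ ^ 2) κ : ℝ) : ℂ) := by
      intro κ
      simp only [Set.indicator_apply]
      split_ifs <;> simp
    simp only [h1] at hnorm
    exact_mod_cast hnorm
  have hvanish : ∀ T : Set (Module.Dual F A), ∑ κ, T.indicator (fun κ => ‖a κ‖ ^ 2) κ ≤ 0 →
      ∀ κ ∈ T, a κ = 0 := by
    intro T hT κ hκ
    have hnn : ∀ κ ∈ Finset.univ, 0 ≤ T.indicator (fun κ => ‖a κ‖ ^ 2) κ := fun κ _ =>
      Set.indicator_nonneg (fun _ _ => by positivity) κ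
    have h1 := (Finset.sum_eq_zero_iff_of_nonneg hnn).1 (le_antisymm hT (Finset.sum_nonneg hnn)) κ
      (Finset.mem_univ _)
    rw [Set.indicator_of_mem hκ] at h1
    simpa using h1
  have hcompl : 0 ≤ ∑ κ, (XiSet lam)ᶜ.indicator (fun κ => ‖a κ‖ ^ 2) κ :=
    Finset.sum_nonneg fun κ _ => Set.indicator_nonneg (fun _ _ => by positivity) κ
  -- The sum over Ξ_λ is the natural number n and the total is 1: if n ≠ 0, nothing is left for the
  -- complement.
  by_cases hn0 : n = 0
  · right
    have hzero : ∀ κ ∈ XiSet lam, a κ = 0 := hvanish _ (by rw [hnorm', hn0]; simp)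
    refine ⟨fun hmem => ?_, hzero⟩
    have hf0 : f = 0 := by
      have : (agreeSet lam).indicator a = 0 := by
        funext κ
        by_cases hκ : κ ∈ agreeSet lam
        · rw [Set.indicator_of_mem hκ]
          exact hzero κ (mem_XiSet_iff.2 ⟨1, by rwa [coadjAct_one]⟩)
        · rw [Set.indicator_of_notMem hκ]; rfl
      rw [hf, this, map_zero]
    have h1 := hmem.2
    rw [hmult, ← Representation.char_one σ, ← hfσ, hf0] at h1
    exact lt_irrefl _ h1
  · left
    have hn1 : (1 : ℝ) ≤ n := by exact_mod_cast Nat.one_le_iff_ne_zero.2 hn0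
    refine ⟨⟨hψm, ?_⟩, hvanish (XiSet lam)ᶜ (by linarith)⟩
    rw [hmult]
    have hW : Module.finrank ℂ W ≠ 0 := by
      intro hW
      have := Module.finrank_zero_iff.1 hW
      apply hn0
      have h0 : σ.character = 0 := by
        funext s
        rw [Representation.character, Subsingleton.elim (σ s) 0, map_zero]; rfl
      rw [h0, charInner_eq_sum] at hn
      have : (n : ℂ) = 0 := by rw [← hn]; simp
      exact_mod_cast this
    exact_mod_cast Nat.pos_of_ne_zero hW

/-- The class functions whose Fourier coefficients are supported on `Ξ_λ`, parametrized by
functions on the set of coadjoint orbits in `Ξ_λ`. -/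
def orbitSynth (θ : AddChar F ℂ) (lam : Module.Dual F A) :
    (coadjOrbitsIn (XiSet lam) → ℂ) →ₗ[ℂ] (AlgGroup A → ℂ) :=
  open Classical in
  dualSynth θ ∘ₗ LinearMap.pi fun κ =>
    if h : coadjOrbit κ ∈ coadjOrbitsIn (XiSet lam) then LinearMap.proj ⟨coadjOrbit κ, h⟩ else 0

theorem dualCoeff_orbitSynth_of_mem (θ : AddChar F ℂ) (hθ : θ ≠ 1) (lam : Module.Dual F A)
    (c : coadjOrbitsIn (XiSet lam) → ℂ) {κ : Module.Dual F A}
    (h : coadjOrbit κ ∈ coadjOrbitsIn (XiSet lam)) :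
    dualCoeff θ (orbitSynth θ lam c) κ = c ⟨coadjOrbit κ, h⟩ := by
  rw [orbitSynth, LinearMap.comp_apply, dualCoeff_dualSynth θ hθ]
  simp [h]

theorem dualCoeff_orbitSynth_of_notMem (θ : AddChar F ℂ) (hθ : θ ≠ 1) (lam : Module.Dual F A)
    (c : coadjOrbitsIn (XiSet lam) → ℂ) {κ : Module.Dual F A}
    (h : κ ∉ XiSet lam) : dualCoeff θ (orbitSynth θ lam c) κ = 0 := by
  rw [← coadjOrbit_mem_coadjOrbitsIn_XiSet] at h
  rw [orbitSynth, LinearMap.comp_apply, dualCoeff_dualSynth θ hθ]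
  simp [h]

theorem orbitSynth_injective (θ : AddChar F ℂ) (hθ : θ ≠ 1) (lam : Module.Dual F A) :
    Function.Injective (orbitSynth θ lam) := by
  rintro c c' h
  funext O
  obtain ⟨_, ⟨κ, rfl⟩, hO⟩ := O
  have h1 : coadjOrbit κ ∈ coadjOrbitsIn (XiSet lam) := ⟨⟨κ, rfl⟩, hO⟩
  rw [← dualCoeff_orbitSynth_of_mem θ hθ lam c h1, h, dualCoeff_orbitSynth_of_mem θ hθ lam c' h1]

theorem mem_range_orbitSynth (θ : AddChar F ℂ) (hθ : θ ≠ 1) (lam : Module.Dual F A)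
    {f : AlgGroup A → ℂ} (hf : ∀ x y, f (x * y * x⁻¹) = f y)
    (hsupp : ∀ κ ∉ XiSet lam, dualCoeff θ f κ = 0) :
    f ∈ LinearMap.range (orbitSynth θ lam) := by
  -- Any representative of the orbit will do, as the coefficients are constant on it.
  refine ⟨fun O => dualCoeff θ f O.2.1.choose, ?_⟩
  rw [← dualSynth_dualCoeff θ hθ f, ← dualSynth_dualCoeff θ hθ (orbitSynth θ lam _)]
  congr 1
  funext κ
  by_cases hκ : κ ∈ XiSet lam
  · have h := coadjOrbit_mem_coadjOrbitsIn_XiSet.2 hκ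
    rw [dualCoeff_orbitSynth_of_mem θ hθ lam _ h, dualSynth_dualCoeff θ hθ]
    obtain ⟨g, hg⟩ := (coadjOrbit_eq_iff _ _).1 h.1.choose_spec
    rw [← dualCoeff_coadjAct θ hf κ g, hg]
  · rw [dualCoeff_orbitSynth_of_notMem θ hθ lam _ hκ, hsupp κ hκ]

theorem orbitSynth_conj (θ : AddChar F ℂ) (lam : Module.Dual F A)
    (c : coadjOrbitsIn (XiSet lam) → ℂ) (x y : AlgGroup A) :
    orbitSynth θ lam c (x * y * x⁻¹) = orbitSynth θ lam c y := by
  refine dualSynth_conj θ (fun κ g => ?_) x y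
  rw [LinearMap.pi_apply, LinearMap.pi_apply, coadjOrbit_coadjAct]

/-- The constituents of `ξ_λ` span the class functions with Fourier coefficients supported
on `Ξ_λ`. -/
theorem span_irrConstituents (θ : AddChar F ℂ) (hθ : θ ≠ 1) (lam : Module.Dual F A) :
    Submodule.span ℂ (irrConstituents (xiChar θ lam)) = LinearMap.range (orbitSynth θ lam) := by
  classical
  have := AlgGroup.finite F A
  apply le_antisymm
  · rw [Submodule.span_le]
    intro ψ hψ
    obtain ⟨d, ρ, -, rfl⟩ := hψ.1
    refine mem_range_orbitSynth θ hθ lam (fun x y => ρ.char_conj y x) ?_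
    rcases dualCoeff_irr θ hθ lam hψ.1 with h | h
    · exact h.2
    · exact absurd hψ h.1
  · rintro _ ⟨c, rfl⟩
    -- The projection cutting the coefficients down to Ξ_λ. By the dichotomy it fixes the
    -- constituents and kills the other irreducible characters, so it maps all class functions into
    -- the span of the constituents.
    let P : (AlgGroup A → ℂ) →ₗ[ℂ] (AlgGroup A → ℂ) :=
      dualSynth θ ∘ₗ (LinearMap.pi fun κ =>
        if κ ∈ XiSet lam then LinearMap.proj κ else 0) ∘ₗ dualCoeff θ
    have hP : ∀ f, P f = dualSynth θ ((XiSet lam).indicator (dualCoeff θ f)) := by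
      intro f
      simp only [P, LinearMap.comp_apply]
      congr 1
      funext κ
      by_cases hκ : κ ∈ XiSet lam <;> simp [hκ]
    have hPself : ∀ f, (∀ κ ∉ XiSet lam, dualCoeff θ f κ = 0) → P f = f := by
      intro f hf
      rw [hP, Set.indicator_eq_self.2, dualSynth_dualCoeff θ hθ]
      intro κ hκ
      by_contra h
      exact hκ (hf κ h)
    have hmem : ∀ f ∈ Submodule.span ℂ (irrCharacters (AlgGroup A)),
        P f ∈ Submodule.span ℂ (irrConstituents (xiChar θ lam)) := by
      intro f hf
      rw [← Submodule.mem_comap]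
      refine Submodule.span_le.2 (fun ψ hψ => ?_) hf
      rw [SetLike.mem_coe, Submodule.mem_comap]
      rcases dualCoeff_irr θ hθ lam hψ with h | h
      · rw [hPself ψ h.2]
        exact Submodule.subset_span h.1
      · have : (XiSet lam).indicator (dualCoeff θ ψ) = 0 := by
          funext κ
          by_cases hκ : κ ∈ XiSet lam
          · rw [Set.indicator_of_mem hκ, h.2 κ hκ]; rfl
          · rw [Set.indicator_of_notMem hκ]; rfl
        rw [hP, this, map_zero]
        exact Submodule.zero_mem _
    rw [← hPself (orbitSynth θ lam c) fun κ hκ => dualCoeff_orbitSynth_of_notMem θ hθ lam c hκ]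
    exact hmem _ (classFun_mem_span_irrCharacters (orbitSynth_conj θ lam c))

end Constituents

end

theorem mainTheorem10 {F A : Type*} [Field F] [Finite F] [NonUnitalRing A] [Module F A]
    [IsScalarTower F A A] [SMulCommClass F A A] [FiniteDimensional F A] [IsNilpotentAlg A]
    (θ : AddChar F ℂ) (hθ : θ ≠ 1) (lam : Module.Dual F A) :
    (irrConstituents (xiChar θ lam)).ncard = (coadjOrbitsIn (XiSet lam)).ncard ∧
    (irrConstituents (xiChar θ lam)).ncard =
      (coadjOrbitsIn (rightOrbit (restrictForm lam (sBar lam)))).ncard := by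
  have h : (irrConstituents (xiChar θ lam)).ncard = (coadjOrbitsIn (XiSet lam)).ncard := by
    have := AlgGroup.finite F A
    have := Module.Dual.finite_of_finite F A
    have := Fintype.ofFinite (Module.Dual F A)
    have := Fintype.ofFinite (coadjOrbitsIn (XiSet lam))
    have hsub : irrConstituents (xiChar θ lam) ⊆ irrCharacters (AlgGroup A) := fun _ h => h.1
    have := ((finite_irrCharacters (AlgGroup A)).subset hsub).fintype
    have h1 := finrank_span_set_eq_card ((linearIndependent_irrCharacters (AlgGroup A)).comp
      (Set.inclusion hsub) (Set.inclusion_injective hsub))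
    -- Both counts are dimensions of one space: the constituents are a basis of it, and `orbitSynth`
    -- parametrizes it by functions on the orbits.
    rw [span_irrConstituents θ hθ, LinearMap.finrank_range_of_inj (orbitSynth_injective θ hθ lam),
      Module.finrank_fintype_fun_eq_card] at h1
    rw [Set.ncard_eq_toFinset_card', ← h1, ← Nat.card_eq_fintype_card]
    rfl
  exact ⟨h, h.trans (ncard_coadjOrbitsIn_XiSet_eq lam)⟩
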